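/- **Setting.** Let $G=(V,E)$ be a finite simple undirected graph with maximum degree $\Delta\ge 2$. Write $N(u)$ for the set of neighbours of $u$, and $\mathrm{dist}$ for the distance in $G$ ($\infty$ between different components). Let $k>2$ and $K\ge 0$ be integers with $k>K$, and put $h=\lfloor k/2\rfloor$. In algorithm $j\in\{1,\dots,\Delta^k\}$ every node $u$ has the local variables $d_u=d^{(j)}_u\in\{0,\dots,k-1\}$, $err_u\in\{0,1\}$ and, for $1\le i\le h-1$, a clock $c_{i,u}\in\mathbb Z/4\mathbb Z$ and an arrow $b_{i,u}\in\{\uparrow,\downarrow\}$ (the superscript $(j)$ is omitted when all variables are those of algorithm $j$). A *parent* (*child*) of $u$ is a $v\in N(u)$ with $d_v=d_u-1$ ($d_v=d_u+1$). Node $u$ is *blocked* if $d^{(p)}_u=0$ for some $p<j$. **Predicates.** - $\mathrm{wd}(u)$: $err_u=0$; $|d_u-d_v|\le1$ for all $v\in N(u)$; if $d_u>0$ and ($u$ is not blocked or $d_u<k-1$), then $u$ has a parent; if $d_u=0$, then $u$ is not blocked. - $\mathrm{up}(u,i)$: every parent $v$ of $u$ has $(b_{i,u},b_{i,v},c_{i,v})\in\{(\uparrow,\uparrow,c_{i,u}),(\uparrow,\downarrow,c_{i,u}),(\uparrow,\downarrow,c_{i,u}+1),(\downarrow,\downarrow,c_{i,u})\}$.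 - $\mathrm{down}(u,i)$: every child $v$ of $u$ has $(b_{i,u},b_{i,v},c_{i,v})\in\{(\uparrow,\uparrow,c_{i,u}),(\downarrow,\uparrow,c_{i,u}),(\downarrow,\uparrow,c_{i,u}-1),(\downarrow,\downarrow,c_{i,u})\}$. - $\mathrm{bc}(u)$: $d_u\ge h$, or both $\mathrm{up}(u,d_u)$ (void if $d_u=0$) and $\mathrm{up}(u,i)\wedge\mathrm{down}(u,i)$ for all $d_u<i\le h-1$. **Rules of algorithm $j$ at node $u$** (guard $\to$ command; in parentheses the priority number, smaller numbers being executed first). Put $m_u=\min(\{d_v+1: v\in N(u)\}\cup\{k-1\})$; $i$ ranges over $1,\dots,h-1$. - *Update distance* (0): $d_u\ne0$ and $d_u\neq m_u$ $\to$ $d_u:=m_u$; if the new $d_u$ is $<h$, choose $w\in N(u)$ with $d_w=d_u-1$ and set $c_{i,u}:=c_{i,w}$, $b_{i,u}:=b_{i,w}$ for all $i\ge d_u$. - *Belong to two ruling sets* (0): $d_u=0$ and $u$ blocked $\to$ $d_u:=1$. - *Become leader* (1): $err_u=0$, $d_u=k-1$, $d_v=k-1$ for all $v\in N(u)$, $u$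 not blocked $\to$ $d_u:=0$ and $c_{i,u}:=0$, $b_{i,u}:=\downarrow$ for all $i$. - *Leader down* (1): $\mathrm{wd}(u)$, $d_u=0$, some $b_{i,u}=\uparrow$ $\to$ $b_{i,u}:=\downarrow$ for all $i$. - *Two heads* (1): $err_u=0$ and two distinct nodes of $N(u)\cup\{u\}$ have $d$-value $0$ $\to$ $err_u:=1$. - *Branch incoherence* (1): $err_u=0$ and not $\mathrm{bc}(u)$ $\to$ $err_u:=1$. - *Remote collision* (1): $err_u=0$, $d_u\le\frac{k-1}2$, and there are $v,v'\in N(u)\cup\{u\}$ with $d_v=d_{v'}=i\in\{1,\dots,h-1\}$ and $c_{i,v}-c_{i,v'}=2$ $\to$ $err_u:=1$. - *Incr leader* (2): $\mathrm{wd}(u)$, $d_u=0$, and for some $i$ all $v\in N(u)$ have $d_v=1$, $c_{i,v}=c_{i,u}$, $b_{i,v}=\uparrow$ $\to$ $c_{i,u}:=c_{i,u}+1$ for all such $i$. - *Sync 1 down* (2): $\mathrm{wd}(u)$, and there is exactly one $v\in N(u)$ such that for some $i$: $d_u=1$, $d_v=0$, $c_{i,u}=c_{i,v}-1$, $b_{i,u}=\uparrow$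 $\to$ for all such $i$, $c_{i,u}:=c_{i,v}$, $b_{i,u}:=\downarrow$. - *Sync 2+ down* (2): $\mathrm{wd}(u)$, $1<d_u<h$, and for some $i\ge d_u$: $b_{i,u}=\uparrow$ and all parents $v$ have $c_{i,u}=c_{i,v}-1$, $b_{i,v}=\downarrow$ $\to$ for all such $i$, $c_{i,u}:=c_{i,v}$ ($v$ a parent), $b_{i,u}:=\downarrow$. - *Sync 1+ up* (2): $\mathrm{wd}(u)$, $0<d_u<h$, and for some $i>d_u$: $b_{i,u}=\downarrow$ and all children $v$ have $c_{i,v}=c_{i,u}$, $b_{i,v}=\uparrow$ $\to$ $b_{i,u}:=\uparrow$ for all such $i$. - *Sync end-of-chain* (2): $\mathrm{wd}(u)$, $0<d_u<h$, and, with $i=d_u$, either all parents $v$ have $c_{i,u}=c_{i,v}-1$, $b_{i,v}=\downarrow$, or $b_{i,u}=\downarrow$ and all parents $v$ have $c_{i,u}=c_{i,v}$, $b_{i,v}=\downarrow$ $\to$ $c_{i,u}:=c_{i,v}$ ($v$ a parent), $b_{i,u}:=\uparrow$. - *Error spread* (2): $err_u=0$, $d_u\le h-1$, and some $v\in N(u)$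 has $err_v=1$, $d_u<d_v$ $\to$ $err_u:=1$. - *Reset error* (2): $err_u=1$, and $d_u>h$ or every $v\in N(u)$ has $d_v\ge d_u$ or $err_v=1$ $\to$ $err_u:=0$ and, if $d_u=0$, then $d_u:=1$ and $c_{i,u}:=0$, $b_{i,u}:=\uparrow$ for all $i$. **Executions.** A node is activable if the guard of some rule of some algorithm holds at it. A step $C\to C'$ activates a non-empty set of activable nodes; each activated node executes, in each of the $\Delta^k$ algorithms, one rule whose guard holds in $C$ and whose priority number is least among such rules of that algorithm (if there is one), all values being read in $C$. An execution is a sequence of such steps from an arbitrary configuration, infinite or ending in a configuration without activable node (then continued by repeating that configuration). It is under the Gouda daemon if, whenever $C\to C'$ is a possible step and $C$ occurs infinitely often, $C'$ also occurs infinitely often. **Theorem (distance-$K$ coloring).** Let $S^{(i)}(C)=\{u\in V: d^{(i)}_u=0 \text{ in } C\}$. Every execution under the Gouda daemon eventually reaches a configuration $C$ such that 1. for every $1\le i\le\Delta^k$, $S^{(i)}(C)$ is a distance-$k$ maximal independent set of $V\setminus\bigcup_{j<i}S^{(j)}(C)$ in $G$, i.e. an inclusion-maximal subset of $V\setminus\bigcup_{j<i}S^{(j)}(C)$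 whose nodes are pairwise at distance at least $k$ in $G$; 2. $S^{(1)}(C),\dots,S^{(\Delta^k)}(C)$ form a distance-$K$ coloring: every node lies in exactly one of these sets, and two distinct nodes at distance at most $K$ never lie in the same one; 3. every configuration of every execution (under any daemon) starting in $C$ satisfies 1 and 2 with the same sets $S^{(i)}$ as $C$. -/

import Mathlib

namespace RulingColoring

/-- The two possible directions of an arrow variable `b`. -/
inductive Arrow
  | up
  | down

/-- Clock indices: the integers `1 ≤ i ≤ ⌊k/2⌋ - 1`. -/
abbrev ClockIdx (k : ℕ) : Type := ↥(Finset.Icc 1 (k / 2 - 1))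

/-- The local variables of a node for one ruling-set algorithm:
`d ∈ {0, …, k-1}`, `err ∈ {0,1}` (`true` is `1`), and, for every clock index `i`,
a clock `c i ∈ ℤ/4ℤ` and an arrow `b i`. -/
structure LocalState (k : ℕ) where
  d : Fin k
  err : Bool
  c : ClockIdx k → ZMod 4
  b : ClockIdx k → Arrow

/-- A configuration of the composition of `N` parallel algorithms, indexed by `Fin N`
(so the index `j : Fin N` is the `(j+1)`-st algorithm). -/
abbrev Config (V : Type*) (k N : ℕ) : Type _ := V → Fin N → LocalState k

variable {V : Type*} {k N : ℕ}

/-- The `d`-value of node `u` for algorithm `j`, as a natural number. -/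
def dist (C : Config V k N) (j : Fin N) (u : V) : ℕ := ((C u j).d : ℕ)

/-- The set `S^{(j)}(C)` of leaders of algorithm `j`. -/
def leaders (C : Config V k N) (j : Fin N) : Set V := {u | dist C j u = 0}

/-- `u` is a leader in some algorithm of smaller number than `j`. -/
def LowerLeader (C : Config V k N) (j : Fin N) (u : V) : Prop := ∃ p : Fin N, p < j ∧ dist C p u = 0

/-! ### Predicates -/

/-- `v` is a neighbour of `u` whose `d`-value is smaller by one. -/
def Parent (G : SimpleGraph V) (C : Config V k N) (j : Fin N) (u v : V) : Prop :=
  G.Adj u v ∧ dist C j v + 1 = dist C j u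

/-- `v` is a neighbour of `u` whose `d`-value is larger by one. -/
def Child (G : SimpleGraph V) (C : Config V k N) (j : Fin N) (u v : V) : Prop :=
  G.Adj u v ∧ dist C j v = dist C j u + 1

/-- `v ∈ N(u) ∪ {u}`. -/
def InClosedNbhd (G : SimpleGraph V) (u v : V) : Prop := v = u ∨ G.Adj u v

/-- The predicate `well_defined^{(j)}(u)`. A node with positive `d`-value needs a parent, except
when its `d`-value is `k-1` and it is a leader in a smaller algorithm. -/
def WellDefined (G : SimpleGraph V) (C : Config V k N) (j : Fin N) (u : V) : Prop :=
  (C u j).err = false ∧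
  (∀ v, G.Adj u v → dist C j u ≤ dist C j v + 1 ∧ dist C j v ≤ dist C j u + 1) ∧
  (0 < dist C j u → (¬ LowerLeader C j u ∨ dist C j u < k - 1) → ∃ v, Parent G C j u v) ∧
  (dist C j u = 0 → ¬ LowerLeader C j u)

/-- `branch_coherence_up(u,i)`; the disjuncts list the allowed triples
`(b_{i,u}, b_{i,v}, c_{i,v})`. -/
def BranchUp (G : SimpleGraph V) (C : Config V k N) (j : Fin N) (u : V) (i : ClockIdx k) : Prop :=
  ∀ v, Parent G C j u v →
    ((C u j).b i = .up ∧ (C v j).b i = .up ∧ (C v j).c i = (C u j).c i) ∨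
    ((C u j).b i = .up ∧ (C v j).b i = .down ∧ (C v j).c i = (C u j).c i) ∨
    ((C u j).b i = .up ∧ (C v j).b i = .down ∧ (C v j).c i = (C u j).c i + 1) ∨
    ((C u j).b i = .down ∧ (C v j).b i = .down ∧ (C v j).c i = (C u j).c i)

/-- `branch_coherence_down(u,i)`. -/
def BranchDown (G : SimpleGraph V) (C : Config V k N) (j : Fin N) (u : V) (i : ClockIdx k) : Prop :=
  ∀ v, Child G C j u v →
    ((C u j).b i = .up ∧ (C v j).b i = .up ∧ (C v j).c i = (C u j).c i) ∨
    ((C u j).b i = .down ∧ (C v j).b i = .up ∧ (C v j).c i = (C u j).c i) ∨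
    ((C u j).b i = .down ∧ (C v j).b i = .up ∧ (C v j).c i = (C u j).c i - 1) ∨
    ((C u j).b i = .down ∧ (C v j).b i = .down ∧ (C v j).c i = (C u j).c i)

/-- `branch_coherence(u)`. For `d_u = 0` the condition on the index `d_u` is void, since such a
node has no parent. -/
def BranchCoherence (G : SimpleGraph V) (C : Config V k N) (j : Fin N) (u : V) : Prop :=
  k / 2 ≤ dist C j u ∨
  ((∀ i : ClockIdx k, (i : ℕ) = dist C j u → BranchUp G C j u i) ∧
   (∀ i : ClockIdx k, dist C j u + 1 ≤ (i : ℕ) → BranchUp G C j u i ∧ BranchDown G C j u i))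

/-! ### Clock indices on which the stationary rules act -/

def IncrIdx (G : SimpleGraph V) (C : Config V k N) (j : Fin N) (u : V) (i : ClockIdx k) : Prop :=
  ∀ v, G.Adj u v → dist C j v = 1 ∧ (C u j).c i - (C v j).c i = 0 ∧ (C v j).b i = .up

def SyncOneIdx (C : Config V k N) (j : Fin N) (u v : V) (i : ClockIdx k) : Prop :=
  dist C j u = 1 ∧ dist C j v = 0 ∧ (C u j).c i = (C v j).c i - 1 ∧ (C u j).b i = .up

def SyncTwoIdx (G : SimpleGraph V) (C : Config V k N) (j : Fin N) (u : V) (i : ClockIdx k) : Prop :=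
  dist C j u ≤ (i : ℕ) ∧ (C u j).b i = .up ∧
  ∀ v, Parent G C j u v → (C u j).c i = (C v j).c i - 1 ∧ (C v j).b i = .down

def SyncUpIdx (G : SimpleGraph V) (C : Config V k N) (j : Fin N) (u : V) (i : ClockIdx k) : Prop :=
  dist C j u + 1 ≤ (i : ℕ) ∧ (C u j).b i = .down ∧
  ∀ v, Child G C j u v → (C u j).c i = (C v j).c i ∧ (C v j).b i = .up

def SyncEndIdx (G : SimpleGraph V) (C : Config V k N) (j : Fin N) (u : V) (i : ClockIdx k) : Prop :=
  (i : ℕ) = dist C j u ∧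
  ((∀ v, Parent G C j u v → (C u j).c i = (C v j).c i - 1 ∧ (C v j).b i = .down) ∨
   ((C u j).b i = .down ∧
    ∀ v, Parent G C j u v → (C u j).c i = (C v j).c i ∧ (C v j).b i = .down))

/-- `min (min {d_v | v ∈ N(u)} + 1) (k-1)`, which is `k-1` if `u` has no neighbour. -/
noncomputable def targetDist (G : SimpleGraph V) (C : Config V k N) (j : Fin N) (u : V) : ℕ :=
  sInf (insert (k - 1) ((fun v => dist C j v + 1) '' G.neighborSet u))

/-! ### Rules -/

/-- The names of the rules of each of the algorithms. -/
inductive Rule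
  | incrLeader
  | syncOneDown
  | syncTwoDown
  | syncUp
  | syncEnd
  | updateDistance
  | becomeLeader
  | leaderDown
  | twoHeads
  | branchIncoherence
  | remoteCollision
  | errorSpread
  | resetError
  | belongToTwo

/-- Priority numbers; the rules of smallest number are executed first. -/
def Rule.priority : Rule → ℕ
  | .updateDistance => 0
  | .belongToTwo => 0
  | .becomeLeader => 1
  | .leaderDown => 1
  | .twoHeads => 1
  | .branchIncoherence => 1
  | .remoteCollision => 1
  | .incrLeader => 2
  | .syncOneDown => 2
  | .syncTwoDown => 2
  | .syncUp => 2
  | .syncEnd => 2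
  | .errorSpread => 2
  | .resetError => 2

/-- The guard of a rule of algorithm `j` at node `u`: the rule is activable at `u`. -/
def Guard (G : SimpleGraph V) (C : Config V k N) (j : Fin N) (u : V) : Rule → Prop
  | .incrLeader => WellDefined G C j u ∧ dist C j u = 0 ∧ ∃ i, IncrIdx G C j u i
  | .syncOneDown => WellDefined G C j u ∧ ∃! v, G.Adj u v ∧ ∃ i, SyncOneIdx C j u v i
  | .syncTwoDown => WellDefined G C j u ∧ 1 < dist C j u ∧ dist C j u < k / 2 ∧
      ∃ i, SyncTwoIdx G C j u i
  | .syncUp => WellDefined G C j u ∧ 0 < dist C j u ∧ dist C j u < k / 2 ∧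
      ∃ i, SyncUpIdx G C j u i
  | .syncEnd => WellDefined G C j u ∧ 0 < dist C j u ∧ dist C j u < k / 2 ∧
      ∃ i, SyncEndIdx G C j u i
  | .updateDistance => dist C j u ≠ 0 ∧ dist C j u ≠ targetDist G C j u
  | .becomeLeader => (C u j).err = false ∧ dist C j u = k - 1 ∧
      (∀ v, G.Adj u v → dist C j v = k - 1) ∧ ¬ LowerLeader C j u
  | .leaderDown => WellDefined G C j u ∧ dist C j u = 0 ∧ ∃ i, (C u j).b i = .up
  | .twoHeads => (C u j).err = false ∧ ∃ v v', InClosedNbhd G u v ∧ InClosedNbhd G u v' ∧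
      v ≠ v' ∧ dist C j v = 0 ∧ dist C j v' = 0
  | .branchIncoherence => (C u j).err = false ∧ ¬ BranchCoherence G C j u
  | .remoteCollision => (C u j).err = false ∧ 2 * dist C j u ≤ k - 1 ∧
      ∃ v v', InClosedNbhd G u v ∧ InClosedNbhd G u v' ∧ dist C j v = dist C j v' ∧
        ∃ i : ClockIdx k, (i : ℕ) = dist C j v ∧ (C v j).c i - (C v' j).c i = 2
  | .errorSpread => (C u j).err = false ∧ dist C j u ≤ k / 2 - 1 ∧
      ∃ v, G.Adj u v ∧ (C v j).err = true ∧ dist C j u < dist C j v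
  | .resetError => (C u j).err = true ∧
      (k / 2 < dist C j u ∨ ∀ v, G.Adj u v → dist C j u ≤ dist C j v ∨ (C v j).err = true)
  | .belongToTwo => dist C j u = 0 ∧ LowerLeader C j u

open Classical in
/-- `Command G C j u R s'`: executing rule `R` of algorithm `j` at node `u` in configuration `C` can
produce the new local state `s'` (the only freedom is the choice of a parent in
`updateDistance`). -/
def Command (G : SimpleGraph V) (C : Config V k N) (j : Fin N) (u : V) (R : Rule)
    (s' : LocalState k) : Prop :=
  let s := C u j
  match R with
  | .incrLeader => s'.d = s.d ∧ s'.err = s.err ∧ s'.b = s.b ∧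
      ∀ i, s'.c i = if IncrIdx G C j u i then s.c i + 1 else s.c i
  | .syncOneDown => s'.d = s.d ∧ s'.err = s.err ∧
      ∃ v, G.Adj u v ∧ (∃ i, SyncOneIdx C j u v i) ∧
        ∀ i, s'.c i = (if SyncOneIdx C j u v i then (C v j).c i else s.c i) ∧
          s'.b i = (if SyncOneIdx C j u v i then .down else s.b i)
  | .syncTwoDown => s'.d = s.d ∧ s'.err = s.err ∧
      ∃ v, Parent G C j u v ∧
        ∀ i, s'.c i = (if SyncTwoIdx G C j u i then (C v j).c i else s.c i) ∧
          s'.b i = (if SyncTwoIdx G C j u i then .down else s.b i)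
  | .syncUp => s'.d = s.d ∧ s'.err = s.err ∧ s'.c = s.c ∧
      ∀ i, s'.b i = if SyncUpIdx G C j u i then .up else s.b i
  | .syncEnd => s'.d = s.d ∧ s'.err = s.err ∧
      ∃ v, Parent G C j u v ∧
        ∀ i, s'.c i = (if SyncEndIdx G C j u i then (C v j).c i else s.c i) ∧
          s'.b i = (if SyncEndIdx G C j u i then .up else s.b i)
  | .updateDistance => (s'.d : ℕ) = targetDist G C j u ∧ s'.err = s.err ∧
      if (s'.d : ℕ) < k / 2 then
        ∃ w, G.Adj u w ∧ dist C j w + 1 = (s'.d : ℕ) ∧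
          ∀ i : ClockIdx k, s'.c i = (if (s'.d : ℕ) ≤ (i : ℕ) then (C w j).c i else s.c i) ∧
            s'.b i = (if (s'.d : ℕ) ≤ (i : ℕ) then (C w j).b i else s.b i)
      else s'.c = s.c ∧ s'.b = s.b
  | .becomeLeader => (s'.d : ℕ) = 0 ∧ s'.err = s.err ∧ ∀ i, s'.c i = 0 ∧ s'.b i = .down
  | .leaderDown => s'.d = s.d ∧ s'.err = s.err ∧ s'.c = s.c ∧ ∀ i, s'.b i = .down
  | .twoHeads => s'.d = s.d ∧ s'.err = true ∧ s'.c = s.c ∧ s'.b = s.b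
  | .branchIncoherence => s'.d = s.d ∧ s'.err = true ∧ s'.c = s.c ∧ s'.b = s.b
  | .remoteCollision => s'.d = s.d ∧ s'.err = true ∧ s'.c = s.c ∧ s'.b = s.b
  | .errorSpread => s'.d = s.d ∧ s'.err = true ∧ s'.c = s.c ∧ s'.b = s.b
  | .resetError => s'.err = false ∧
      if dist C j u = 0 then (s'.d : ℕ) = 1 ∧ ∀ i, s'.c i = 0 ∧ s'.b i = .up
      else s'.d = s.d ∧ s'.c = s.c ∧ s'.b = s.b
  | .belongToTwo => (s'.d : ℕ) = 1 ∧ s'.err = s.err ∧ s'.c = s.c ∧ s'.b = s.b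

/-! ### Executions -/

/-- Node `u` is eligible for rule `R` of algorithm `j`. -/
def Eligible (G : SimpleGraph V) (C : Config V k N) (j : Fin N) (u : V) (R : Rule) : Prop :=
  Guard G C j u R ∧ ∀ R', Guard G C j u R' → R.priority ≤ R'.priority

/-- Node `u` is activable: some rule of one of the algorithms is activable at `u`. -/
def Activable (G : SimpleGraph V) (C : Config V k N) (u : V) : Prop :=
  ∃ j R, Guard G C j u R

/-- `C → C'`: a non-empty set `A` of activable nodes is activated, and each activated node executes,
in every one of the algorithms, a rule for which it is eligible, if there is one. -/
def Step (G : SimpleGraph V) (C C' : Config V k N) : Prop :=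
  ∃ A : Set V, A.Nonempty ∧ (∀ u ∈ A, Activable G C u) ∧
    (∀ u, u ∉ A → C' u = C u) ∧
    ∀ u ∈ A, ∀ j,
      (∃ R, Eligible G C j u R ∧ Command G C j u R (C' u j)) ∨
      ((∀ R, ¬ Guard G C j u R) ∧ C' u j = C u j)

/-- An execution, as an infinite sequence of configurations. An execution which reaches a
configuration without activable node is over, and is continued by repeating that configuration. -/
def IsExecution (G : SimpleGraph V) (σ : ℕ → Config V k N) : Prop :=
  ∀ n, Step G (σ n) (σ (n + 1)) ∨ ((∀ u, ¬ Activable G (σ n) u) ∧ σ (n + 1) = σ n)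

/-- An execution under the Gouda daemon. -/
def IsGoudaExecution (G : SimpleGraph V) (σ : ℕ → Config V k N) : Prop :=
  IsExecution G σ ∧
  ∀ C C' : Config V k N, Step G C C' →
    (∃ᶠ n in Filter.atTop, σ n = C) → ∃ᶠ n in Filter.atTop, σ n = C'

/-! ### Specification -/

/-- `S` is a distance-`k` maximal independent set of `W` in `G`: a subset of `W` whose nodes are
pairwise at distance at least `k` in `G`, maximal among those subsets. -/
def IsDistanceMIS (G : SimpleGraph V) (k : ℕ) (W S : Set V) : Prop :=
  Maximal (fun T : Set V => T ⊆ W ∧ ∀ u ∈ T, ∀ v ∈ T, u ≠ v → (k : ℕ∞) ≤ G.edist u v) S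

/-- `col` is a distance-`K` coloring of `G`. -/
def IsDistanceColoring {α : Type*} (G : SimpleGraph V) (K : ℕ) (col : V → α) : Prop :=
  ∀ u v, u ≠ v → G.edist u v ≤ (K : ℕ∞) → col u ≠ col v

/-- The sets `S i` are the color classes of a distance-`K` coloring of `G`: every node lies in
exactly one of them, and the corresponding map is a distance-`K` coloring. -/
def FormDistanceColoring {ι : Type*} (G : SimpleGraph V) (K : ℕ) (S : ι → Set V) : Prop :=
  ∃ col : V → ι, (∀ v i, v ∈ S i ↔ col v = i) ∧ IsDistanceColoring G K col

/-- The specification of the distance-`K` coloring algorithm. -/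
def Correct (G : SimpleGraph V) (K : ℕ) (C : Config V k N) : Prop :=
  (∀ i : Fin N, IsDistanceMIS G k (Set.univ \ ⋃ j : Fin N, ⋃ _ : j < i, leaders C j) (leaders C i)) ∧
  FormDistanceColoring G K (leaders C)

end RulingColoring

/-!
A configuration is legitimate for algorithm `j` (`Legit`) if no leader is blocked, the leaders are
pairwise at distance at least `k`, every unblocked node has a leader at distance less than `k`, the
`d`-values are the distances to the leaders (cut off at `k - 1`), no error bit is set, and the
clocks are coherent along all parent edges. If this holds for all algorithms, the sets of leaders
are the maximal independent sets required, and they cover all nodes: a node that is a leader nowhere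
would have `Δ ^ k` distinct leaders, one for each algorithm, at distance less than `k`, and
`card_ball_lt` says that a ball of radius `k - 1` is smaller than that (`correct_of_legit`).

Legitimacy is closed under steps (`Legit.step`). The clock values in the cell of a leader are that
of the leader or one less (`Stable.clock_cell`), and leaders are so far apart that a node only ever
compares clocks of one cell, so there is no remote collision; all that can move is a clock, and
coherence of an edge survives simultaneous moves of both ends (`CohPair.move`).

As there are finitely many configurations, an execution under the Gouda daemon visits some
configuration infinitely often, and then also everything reachable from it. It therefore
suffices to reach, from any configuration, one that is legitimate for all algorithms
(`exists_reach_legit`). The algorithms are treated in order, as the earlier ones stay legitimate with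
the same leaders, and only one node is activated at a time.

For one algorithm, first the number of leaders is made as small as possible. Blocked leaders resign,
and so does some leader whenever an error appears at a level at most `⌊k/2⌋`, because the error can
spread down to it (`Stable.canLose_of_err`). Hence, in a configuration where no leader can be lost
(`Stuck`), no rule that raises an error is ever enabled, and clock moves never destroy
coherence. If two leaders were at distance less than `k` there, one could run a suitable clock in the
cell of one of them, with everything else frozen, until it differs by two from the clock in the
cell of the other one; this would be a remote collision (`Stuck.good`). Finally, as long as some
unblocked node is at distance at least `k` from all leaders, it becomes a leader and its cell is
built by lowering distances, all clocks in it being copies of its own (`Good.exists_more_leaders`).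
-/

namespace RulingColoring

open SimpleGraph

variable {V : Type*} {k N : ℕ}

/-! ### Distances in the graph -/

/-- The nodes `u` and `v` are at distance at most `n` in `G`. -/
def Near (G : SimpleGraph V) (n : ℕ) (u v : V) : Prop := G.edist u v ≤ n

section Near

variable {G : SimpleGraph V} {u v w : V} {m n : ℕ}

lemma near_zero : Near G 0 u v ↔ u = v := by
  simp [Near, edist_eq_zero_iff]

lemma near_one : Near G 1 u v ↔ G.Adj u v ∨ u = v := by
  simp [Near, edist_le_one_iff_adj_or_eq]

lemma Near.of_adj (h : G.Adj u v) : Near G 1 u v := near_one.2 (Or.inl h)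

lemma Near.refl (u : V) : Near G n u u := by simp [Near]

lemma Near.symm (h : Near G n u v) : Near G n v u := by
  rwa [Near, edist_comm]

lemma Near.mono (h : Near G m u v) (hmn : m ≤ n) : Near G n u v :=
  h.trans (by exact_mod_cast hmn)

lemma Near.trans (h : Near G m u v) (h' : Near G n v w) : Near G (m + n) u w := by
  unfold Near at *
  push_cast
  exact G.edist_triangle.trans (add_le_add h h')

lemma Near.split (h : Near G (m + n) u v) : ∃ w, Near G m u w ∧ Near G n w v := by
  have ht : G.edist u v ≠ ⊤ := ne_top_of_le_ne_top (ENat.natCast_ne_top _) h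
  obtain ⟨p, hp⟩ := exists_walk_of_edist_ne_top ht
  have hl : p.length ≤ m + n := by
    unfold Near at h
    rw [← hp] at h
    exact_mod_cast h
  refine ⟨p.getVert m, ?_, ?_⟩
  · refine (edist_le (p.take m)).trans ?_
    rw [Walk.take_length]
    exact_mod_cast min_le_left _ _
  · refine (edist_le (p.drop m)).trans ?_
    rw [Walk.drop_length]
    exact_mod_cast (by omega)

lemma not_near_of_le_edist (h : (m : ℕ∞) ≤ G.edist u v) (hn : n < m) : ¬ Near G n u v := by
  intro h'
  have : (m : ℕ∞) ≤ n := h.trans h'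
  have : m ≤ n := by exact_mod_cast this
  omega

lemma near_of_edist_lt (h : G.edist u v < (m + 1 : ℕ)) : Near G m u v := by
  unfold Near
  push_cast at h
  exact Order.le_of_lt_add_one h

open Classical in
/-- A ball of radius `r` in a graph of maximum degree `Δ ≥ 2` has fewer than `Δ ^ (r + 1)`
nodes. -/
lemma card_ball_lt [Fintype V] (G : SimpleGraph V) [DecidableRel G.Adj] (hΔ : 2 ≤ G.maxDegree)
    (r : ℕ) (u : V) :
    (Finset.univ.filter fun v => Near G r u v).card < G.maxDegree ^ (r + 1) := by
  induction r generalizing u with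
  | zero =>
    have : (Finset.univ.filter fun v => Near G 0 u v) = {u} := by
      ext v
      simp [near_zero, eq_comm]
    rw [this]
    simp
    omega
  | succ r ih =>
    have hsub : (Finset.univ.filter fun v => Near G (r + 1) u v) ⊆
        insert u ((G.neighborFinset u).biUnion
          fun w => Finset.univ.filter fun v => Near G r w v) := by
      intro v hv
      simp only [Finset.mem_filter, Finset.mem_univ, true_and] at hv
      by_cases huv : u = v
      · simp [huv]
      have ht : G.edist u v ≠ ⊤ := ne_top_of_le_ne_top (ENat.natCast_ne_top _) hv
      obtain ⟨p, hp⟩ := exists_walk_of_edist_ne_top ht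
      cases p with
      | nil => exact absurd rfl huv
      | @cons _ w _ ha p =>
        have hwv : Near G r w v := by
          refine (edist_le p).trans ?_
          unfold Near at hv
          rw [← hp, Walk.length_cons] at hv
          have : p.length + 1 ≤ r + 1 := by exact_mod_cast hv
          exact_mod_cast Nat.le_of_succ_le_succ this
        refine Finset.mem_insert_of_mem (Finset.mem_biUnion.2 ⟨w, by simpa using ha, ?_⟩)
        simpa using hwv
    have h1 : ((G.neighborFinset u).biUnion
          fun w => Finset.univ.filter fun v => Near G r w v).card ≤
        G.maxDegree * (G.maxDegree ^ (r + 1) - 1) := by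
      refine (Finset.card_biUnion_le_card_mul _ _ (G.maxDegree ^ (r + 1) - 1) ?_).trans ?_
      · intro w _
        have := ih w
        omega
      · exact Nat.mul_le_mul_right _ (G.degree_le_maxDegree u)
    have h2 := (Finset.card_le_card hsub).trans (Finset.card_insert_le _ _)
    have h3 : G.maxDegree ^ (r + 1 + 1) = G.maxDegree * (G.maxDegree ^ (r + 1) - 1)
        + G.maxDegree := by
      have : 1 ≤ G.maxDegree ^ (r + 1) := Nat.one_le_pow _ _ (by omega)
      rw [pow_succ' G.maxDegree (r + 1)]
      nth_rewrite 1 [show G.maxDegree ^ (r + 1) = (G.maxDegree ^ (r + 1) - 1) + 1 by omega]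
      ring
    omega

end Near

/-! ### Steps at a single node -/

section Target

variable (G : SimpleGraph V) (C : Config V k N) (j : Fin N)

lemma dist_lt (u : V) : dist C j u < k := (C u j).d.2

lemma targetDist_le_pred (u : V) : targetDist G C j u ≤ k - 1 :=
  Nat.sInf_le (Set.mem_insert _ _)

variable {G}

lemma targetDist_le {u v : V} (h : G.Adj u v) : targetDist G C j u ≤ dist C j v + 1 :=
  Nat.sInf_le (Set.mem_insert_of_mem _ ⟨v, h, rfl⟩)

variable (G)

lemma targetDist_cases (u : V) :
    targetDist G C j u = k - 1 ∨ ∃ v, G.Adj u v ∧ dist C j v + 1 = targetDist G C j u := by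
  have h : targetDist G C j u ∈ insert (k - 1) ((fun v => dist C j v + 1) '' G.neighborSet u) :=
    Nat.sInf_mem ⟨_, Set.mem_insert _ _⟩
  rcases h with h | ⟨v, hv, h⟩
  · exact Or.inl h
  · exact Or.inr ⟨v, hv, h⟩

lemma one_le_targetDist (hk : 2 < k) (u : V) : 1 ≤ targetDist G C j u := by
  rcases targetDist_cases G C j u with h | ⟨v, _, h⟩ <;> omega

variable {G} {C} {j}

lemma WellDefined.exists_parent {u : V} (h : WellDefined G C j u) (h0 : 0 < dist C j u)
    (h1 : dist C j u < k - 1) : ∃ v, Parent G C j u v :=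
  h.2.2.1 h0 (Or.inr h1)

end Target

open Classical in
/-- Every enabled rule can be executed. -/
lemma exists_command (G : SimpleGraph V) (C : Config V k N) (j : Fin N) (hk : 2 < k) (u : V)
    (R : Rule) (h : Guard G C j u R) : ∃ s', Command G C j u R s' := by
  cases R with
  | incrLeader =>
    exact ⟨⟨(C u j).d, (C u j).err, fun i => if IncrIdx G C j u i then (C u j).c i + 1
      else (C u j).c i, (C u j).b⟩, rfl, rfl, rfl, fun i => rfl⟩
  | syncOneDown =>
    obtain ⟨_, v, ⟨hv, hi⟩, _⟩ := h
    exact ⟨⟨(C u j).d, (C u j).err,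
      fun i => if SyncOneIdx C j u v i then (C v j).c i else (C u j).c i,
      fun i => if SyncOneIdx C j u v i then .down else (C u j).b i⟩,
      rfl, rfl, v, hv, hi, fun i => ⟨rfl, rfl⟩⟩
  | syncTwoDown =>
    obtain ⟨hw, h1, h2, _⟩ := h
    obtain ⟨v, hv⟩ := hw.exists_parent (by omega) (by omega)
    exact ⟨⟨(C u j).d, (C u j).err,
      fun i => if SyncTwoIdx G C j u i then (C v j).c i else (C u j).c i,
      fun i => if SyncTwoIdx G C j u i then .down else (C u j).b i⟩,
      rfl, rfl, v, hv, fun i => ⟨rfl, rfl⟩⟩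
  | syncUp =>
    exact ⟨⟨(C u j).d, (C u j).err, (C u j).c,
      fun i => if SyncUpIdx G C j u i then .up else (C u j).b i⟩,
      rfl, rfl, rfl, fun i => rfl⟩
  | syncEnd =>
    obtain ⟨hw, h1, h2, _⟩ := h
    obtain ⟨v, hv⟩ := hw.exists_parent (by omega) (by omega)
    exact ⟨⟨(C u j).d, (C u j).err,
      fun i => if SyncEndIdx G C j u i then (C v j).c i else (C u j).c i,
      fun i => if SyncEndIdx G C j u i then .up else (C u j).b i⟩,
      rfl, rfl, v, hv, fun i => ⟨rfl, rfl⟩⟩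
  | updateDistance =>
    have hlt : targetDist G C j u < k := by
      have := targetDist_le_pred G C j u
      omega
    by_cases hh : targetDist G C j u < k / 2
    · rcases targetDist_cases G C j u with h' | ⟨w, hw, h'⟩
      · omega
      refine ⟨⟨⟨targetDist G C j u, hlt⟩, (C u j).err,
        fun i => if targetDist G C j u ≤ (i : ℕ) then (C w j).c i else (C u j).c i,
        fun i => if targetDist G C j u ≤ (i : ℕ) then (C w j).b i else (C u j).b i⟩,
        rfl, rfl, ?_⟩
      simp only [hh, if_true]
      exact ⟨w, hw, h', fun i => ⟨rfl, rfl⟩⟩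
    · refine ⟨⟨⟨targetDist G C j u, hlt⟩, (C u j).err, (C u j).c, (C u j).b⟩, rfl, rfl, ?_⟩
      simp [hh]
  | becomeLeader =>
    exact ⟨⟨⟨0, by omega⟩, (C u j).err, fun _ => 0, fun _ => .down⟩, rfl, rfl,
      fun _ => ⟨rfl, rfl⟩⟩
  | leaderDown =>
    exact ⟨⟨(C u j).d, (C u j).err, (C u j).c, fun _ => .down⟩, rfl, rfl, rfl, fun _ => rfl⟩
  | twoHeads => exact ⟨⟨(C u j).d, true, (C u j).c, (C u j).b⟩, rfl, rfl, rfl, rfl⟩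
  | branchIncoherence => exact ⟨⟨(C u j).d, true, (C u j).c, (C u j).b⟩, rfl, rfl, rfl, rfl⟩
  | remoteCollision => exact ⟨⟨(C u j).d, true, (C u j).c, (C u j).b⟩, rfl, rfl, rfl, rfl⟩
  | errorSpread => exact ⟨⟨(C u j).d, true, (C u j).c, (C u j).b⟩, rfl, rfl, rfl, rfl⟩
  | resetError =>
    by_cases h0 : dist C j u = 0
    · refine ⟨⟨⟨1, by omega⟩, false, fun _ => 0, fun _ => .up⟩, rfl, ?_⟩
      simp [h0]
    · refine ⟨⟨(C u j).d, false, (C u j).c, (C u j).b⟩, rfl, ?_⟩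
      simp [h0]
  | belongToTwo =>
    exact ⟨⟨⟨1, by omega⟩, (C u j).err, (C u j).c, (C u j).b⟩, rfl, rfl, rfl, rfl⟩

lemma exists_eligible (G : SimpleGraph V) (C : Config V k N) (j : Fin N) (u : V)
    (h : ∃ R, Guard G C j u R) : ∃ R, Eligible G C j u R := by
  classical
  have hex : ∃ n R, Guard G C j u R ∧ R.priority = n := by
    obtain ⟨R, hR⟩ := h
    exact ⟨_, R, hR, rfl⟩
  obtain ⟨R, hR, hn⟩ := Nat.find_spec hex
  exact ⟨R, hR, fun R' hR' => hn ▸ Nat.find_min' hex ⟨R', hR', rfl⟩⟩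

/-- An eligible rule of algorithm `j` at a node `u` can be executed in a step which activates
no other node. -/
lemma exists_step (G : SimpleGraph V) (C : Config V k N) (j : Fin N) (hk : 2 < k) (u : V)
    (R : Rule) (s' : LocalState k) (hR : Eligible G C j u R) (hc : Command G C j u R s') :
    ∃ C', Step G C C' ∧ C' u j = s' ∧ ∀ v, v ≠ u → C' v = C v := by
  classical
  have hall : ∀ j', ∃ t, (∃ R, Eligible G C j' u R ∧ Command G C j' u R t) ∨
      ((∀ R, ¬ Guard G C j' u R) ∧ t = C u j') := by
    intro j'
    by_cases h : ∃ R, Guard G C j' u R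
    · obtain ⟨R', hR'⟩ := exists_eligible G C j' u h
      obtain ⟨t, ht⟩ := exists_command G C j' hk u R' hR'.1
      exact ⟨t, Or.inl ⟨R', hR', ht⟩⟩
    · push Not at h
      exact ⟨C u j', Or.inr ⟨h, rfl⟩⟩
  choose t ht using hall
  refine ⟨Function.update C u (Function.update t j s'), ⟨{u}, ⟨u, rfl⟩, ?_, ?_, ?_⟩, ?_, ?_⟩
  · rintro v rfl
    exact ⟨j, R, hR.1⟩
  · intro v hv
    exact Function.update_of_ne hv _ _
  · rintro v rfl j'
    rw [Function.update_self]
    by_cases hj : j' = j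
    · subst hj
      rw [Function.update_self]
      exact Or.inl ⟨R, hR, hc⟩
    · rw [Function.update_of_ne hj]
      exact ht j'
  · simp
  · intro v hv
    exact Function.update_of_ne hv _ _

/-! ### Legitimate configurations -/

/-- The triples `(b_{i,u}, b_{i,v}, c_{i,v})` allowed by `branch_coherence_up` for a node in state
`s` and a parent in state `t`. -/
def CohPair (i : ClockIdx k) (s t : LocalState k) : Prop :=
  (s.b i = .up ∧ t.b i = .up ∧ t.c i = s.c i) ∨
  (s.b i = .up ∧ t.b i = .down ∧ t.c i = s.c i) ∨
  (s.b i = .up ∧ t.b i = .down ∧ t.c i = s.c i + 1) ∨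
  (s.b i = .down ∧ t.b i = .down ∧ t.c i = s.c i)

/-- Every pair of a node and a parent is coherent for all the clocks that run through the node. -/
def Coherent (G : SimpleGraph V) (C : Config V k N) (j : Fin N) : Prop :=
  ∀ u v, Parent G C j u v → ∀ i : ClockIdx k, dist C j u ≤ (i : ℕ) → CohPair i (C u j) (C v j)

/-- No leader is blocked, and no node can update its distance. -/
structure Stable (G : SimpleGraph V) (C : Config V k N) (j : Fin N) : Prop where
  unblocked : ∀ u, dist C j u = 0 → ¬ LowerLeader C j u
  eq_target : ∀ u, dist C j u ≠ 0 → dist C j u = targetDist G C j u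

/-- No node has its error bit set. -/
def NoErr (C : Config V k N) (j : Fin N) : Prop := ∀ u, (C u j).err = false

/-- A configuration in which algorithm `j` has a consistent set of leaders, possibly not a maximal
one. -/
structure Good (G : SimpleGraph V) (C : Config V k N) (j : Fin N) : Prop where
  stable : Stable G C j
  noErr : NoErr C j
  coherent : Coherent G C j
  separated : ∀ u ∈ leaders C j, ∀ v ∈ leaders C j, u ≠ v → (k : ℕ∞) ≤ G.edist u v

/-- A configuration which is legitimate for algorithm `j`: it is good, and every unblocked node is
at distance less than `k` from a leader. -/
structure Legit (G : SimpleGraph V) (C : Config V k N) (j : Fin N) : Prop where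
  good : Good G C j
  covered : ∀ u, ¬ LowerLeader C j u → ∃ s ∈ leaders C j, G.edist u s < k

lemma not_lowerLeader_iff (C : Config V k N) (i : Fin N) (u : V) :
    u ∈ Set.univ \ ⋃ j : Fin N, ⋃ _ : j < i, leaders C j ↔ ¬ LowerLeader C i u := by
  simp [LowerLeader, leaders]

/-- If all algorithms are in a legitimate configuration, then the specification holds. A node
which is a leader nowhere would have, for each algorithm, a leader at distance less than `k`; this
gives more nodes than a ball of radius `k - 1` contains. -/
lemma correct_of_legit [Fintype V] (G : SimpleGraph V) [DecidableRel G.Adj]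
    (hΔ : 2 ≤ G.maxDegree) (K : ℕ) (hk : 2 < k) (hK : K < k)
    (C : Config V k (G.maxDegree ^ k)) (h : ∀ j, Legit G C j) : Correct G K C := by
  classical
  refine ⟨fun i => ⟨⟨?_, (h i).good.separated⟩, ?_⟩, ?_⟩
  · intro u hu
    rw [not_lowerLeader_iff]
    exact (h i).good.stable.unblocked u hu
  · rintro T ⟨hT, hsep⟩ hST t ht
    obtain ⟨s, hs, hst⟩ := (h i).covered t ((not_lowerLeader_iff C i t).1 (hT ht))
    by_contra hne
    have : t ≠ s := fun e => hne (e ▸ hs)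
    exact absurd (hsep t ht s (hST hs) this) (not_le.2 hst)
  · have huniq : ∀ u i i', dist C i u = 0 → dist C i' u = 0 → i = i' := by
      intro u i i' hi hi'
      rcases lt_trichotomy i i' with hlt | heq | hlt
      · exact absurd ⟨i, hlt, hi⟩ ((h i').good.stable.unblocked u hi')
      · exact heq
      · exact absurd ⟨i', hlt, hi'⟩ ((h i).good.stable.unblocked u hi)
    have hex : ∀ u, ∃ i, dist C i u = 0 := by
      intro u
      by_contra hno
      push Not at hno
      have : ∀ i, ∃ s, dist C i s = 0 ∧ Near G (k - 1) u s := by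
        intro i
        obtain ⟨s, hs, hus⟩ := (h i).covered u (by rintro ⟨p, _, hp⟩; exact hno p hp)
        refine ⟨s, hs, near_of_edist_lt ?_⟩
        rwa [show k - 1 + 1 = k by omega]
      choose f hf hnear using this
      have hinj : Function.Injective f := fun i i' e => huniq (f i) i i' (hf i) (e ▸ hf i')
      have h1 : (Finset.univ.image f).card = G.maxDegree ^ k := by
        rw [Finset.card_image_of_injective _ hinj]
        simp
      have h2 : (Finset.univ.image f) ⊆ Finset.univ.filter fun v => Near G (k - 1) u v := by
        intro v hv
        obtain ⟨i, _, rfl⟩ := Finset.mem_image.1 hv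
        simpa using hnear i
      have h3 := card_ball_lt G hΔ (k - 1) u
      have h4 := Finset.card_le_card h2
      rw [show k - 1 + 1 = k by omega] at h3
      omega
    choose col hcol using hex
    refine ⟨col, fun v i => ⟨fun hv => huniq v _ _ (hcol v) hv, fun e => e ▸ hcol v⟩, ?_⟩
    intro u v huv hd e
    have := (h (col u)).good.separated u (hcol u) v
      (by have := hcol v; rw [← e] at this; exact this) huv
    exact not_near_of_le_edist this hK hd

/-! ### Stable and good configurations -/

section Stable

variable {G : SimpleGraph V} {C : Config V k N} {j : Fin N} {u v s : V} {n : ℕ}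

lemma Stable.dist_le_succ (h : Stable G C j) (ha : G.Adj u v) : dist C j u ≤ dist C j v + 1 := by
  by_cases h0 : dist C j u = 0
  · omega
  · rw [h.eq_target u h0]
    exact targetDist_le C j ha

lemma Stable.exists_parent (h : Stable G C j) (h0 : dist C j u ≠ 0) (h1 : dist C j u < k - 1) :
    ∃ v, Parent G C j u v := by
  have ht := h.eq_target u h0
  rcases targetDist_cases G C j u with h' | ⟨v, hv, h'⟩
  · omega
  · exact ⟨v, hv, by omega⟩

lemma Stable.dist_le_of_near (h : Stable G C j) (hs : dist C j s = 0) (hn : Near G n u s) :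
    dist C j u ≤ n := by
  induction n generalizing u with
  | zero =>
    rw [near_zero] at hn
    subst hn
    omega
  | succ n ih =>
    rw [add_comm] at hn
    obtain ⟨w, hw, hws⟩ := hn.split
    have := ih hws
    rcases near_one.1 hw with hw | rfl
    · have := h.dist_le_succ hw
      omega
    · omega

lemma Stable.exists_leader (h : Stable G C j) (h1 : dist C j u < k - 1) :
    ∃ s, dist C j s = 0 ∧ Near G (dist C j u) u s := by
  generalize hn : dist C j u = n at *
  induction n generalizing u with
  | zero => exact ⟨u, hn, Near.refl u⟩
  | succ n ih =>
    obtain ⟨v, hv, hd⟩ := h.exists_parent (by omega : dist C j u ≠ 0) (by omega)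
    obtain ⟨s, hs, hvs⟩ := @ih v (by omega) (by omega)
    refine ⟨s, hs, ?_⟩
    rw [add_comm]
    exact (Near.of_adj hv).trans hvs

lemma Stable.wellDefined (h : Stable G C j) (he : (C u j).err = false)
    (h1 : dist C j u < k - 1) : WellDefined G C j u :=
  ⟨he, fun _ hv => ⟨h.dist_le_succ hv, h.dist_le_succ hv.symm⟩,
    fun h0 _ => h.exists_parent (by omega) h1, fun h0 => h.unblocked u h0⟩

lemma Stable.not_updateDistance (h : Stable G C j) : ¬ Guard G C j u .updateDistance :=
  fun hg => hg.2 (h.eq_target u hg.1)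

lemma Stable.not_belongToTwo (h : Stable G C j) : ¬ Guard G C j u .belongToTwo :=
  fun hg => h.unblocked u hg.1 hg.2

/-- The state of clock `i` in the cell of a leader `s`: the value is that of `s`, or one less, in
which case the arrow of the node points up and that of `s` points down. -/
lemma Stable.clock_cell (h : Stable G C j) (hc : Coherent G C j) (hs : dist C j s = 0)
    (i : ClockIdx k) (hu : Near G (dist C j u) u s) (hi : dist C j u ≤ (i : ℕ)) :
    ((C u j).b i = .up ∧ (C u j).c i = (C s j).c i) ∨
    ((C u j).b i = .down ∧ (C s j).b i = .down ∧ (C u j).c i = (C s j).c i) ∨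
    ((C u j).b i = .up ∧ (C s j).b i = .down ∧ (C s j).c i = (C u j).c i + 1) := by
  generalize hn : dist C j u = n at *
  induction n generalizing u with
  | zero =>
    rw [near_zero] at hu
    subst hu
    cases (C u j).b i <;> simp
  | succ n ih =>
    rw [add_comm] at hu
    obtain ⟨w, hw, hws⟩ := hu.split
    have h1 := h.dist_le_of_near hs hws
    rcases near_one.1 hw with hw | rfl
    · have h2 := h.dist_le_succ hw
      have hp : Parent G C j u w := ⟨hw, by omega⟩
      have h3 := hc u w hp i (by omega)
      have h4 := @ih w (by omega) hws (by omega)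
      rcases h3 with ⟨a, b, c⟩ | ⟨a, b, c⟩ | ⟨a, b, c⟩ | ⟨a, b, c⟩ <;>
        rcases h4 with ⟨a', b'⟩ | ⟨a', b', c'⟩ | ⟨a', b', c'⟩ <;> simp_all
    · omega

lemma forall_branchCoherence_iff :
    (∀ u, BranchCoherence G C j u) ↔ Coherent G C j := by
  constructor
  · intro hb u v huv i hi
    have hi2 := (Finset.mem_Icc.1 i.2).2
    have hd := huv.2
    rcases hb u with hb | hb
    · omega
    · rcases hi.eq_or_lt with hi | hi
      · exact hb.1 i hi.symm v huv
      · exact (hb.2 i hi).1 v huv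
  · intro hc u
    refine Or.inr ⟨fun i hi v hv => hc u v hv i hi.ge, fun i hi =>
      ⟨fun v hv => hc u v hv i (by omega), fun v hv => ?_⟩⟩
    have := hc v u ⟨hv.1.symm, hv.2.symm⟩ i (by rw [hv.2]; exact hi)
    rcases this with ⟨a, b, c⟩ | ⟨a, b, c⟩ | ⟨a, b, c⟩ | ⟨a, b, c⟩ <;> simp_all

end Stable

section Good

variable {G : SimpleGraph V} {C : Config V k N} {j : Fin N} {u v s t : V} {n : ℕ}

lemma Good.eq_of_near (h : Good G C j) (hs : dist C j s = 0) (ht : dist C j t = 0) (hn : n < k)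
    (hst : Near G n s t) : s = t := by
  by_contra hne
  exact not_near_of_le_edist (h.separated s hs t ht hne) hn hst

lemma Good.not_twoHeads (h : Good G C j) (hk : 2 < k) : ¬ Guard G C j u .twoHeads := by
  rintro ⟨_, v, v', hv, hv', hne, h0, h0'⟩
  have h1 : ∀ w, InClosedNbhd G u w → Near G 1 w u := by
    rintro w (rfl | hw)
    · exact Near.refl w
    · exact (Near.of_adj hw).symm
  exact hne (h.eq_of_near h0 h0' (by omega : 1 + 1 < k) ((h1 v hv).trans (h1 v' hv').symm))

lemma Good.not_branchIncoherence (h : Good G C j) : ¬ Guard G C j u .branchIncoherence :=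
  fun hg => hg.2 (forall_branchCoherence_iff.2 h.coherent u)

/-- The nodes which a remote collision compares belong to the cell of one leader, where two values
of a clock never differ by two. -/
lemma Good.not_remoteCollision (h : Good G C j) (hk : 2 < k) :
    ¬ Guard G C j u .remoteCollision := by
  rintro ⟨_, hu, v, v', hv, hv', hd, i, hi, hc⟩
  have hi2 := Finset.mem_Icc.1 i.2
  obtain ⟨a, ha, hua⟩ := h.stable.exists_leader (by omega : dist C j u < k - 1)
  have key : ∀ w, InClosedNbhd G u w → dist C j w = i → Near G (dist C j w) w a := by
    intro w hw hwi
    obtain ⟨s, hs, hws⟩ := h.stable.exists_leader (by omega : dist C j w < k - 1)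
    have h1 : Near G 1 u w ∧ dist C j u ≤ dist C j w + 1 := by
      rcases hw with rfl | hw
      · exact ⟨Near.refl w, by omega⟩
      · exact ⟨Near.of_adj hw, h.stable.dist_le_succ hw⟩
    have : a = s := h.eq_of_near ha hs (by omega) ((hua.symm.trans h1.1).trans hws)
    rwa [this]
  have h1 := h.stable.clock_cell h.coherent ha i (key v hv hi.symm) hi.ge
  have h2 := h.stable.clock_cell h.coherent ha i (key v' hv' (by omega)) (by omega)
  have h1' : (C a j).c i = (C v j).c i ∨ (C a j).c i = (C v j).c i + 1 := by
    rcases h1 with h1 | h1 | h1 <;> simp [h1]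
  have h2' : (C a j).c i = (C v' j).c i ∨ (C a j).c i = (C v' j).c i + 1 := by
    rcases h2 with h2 | h2 | h2 <;> simp [h2]
  generalize (C a j).c i = x at *
  generalize (C v j).c i = y at *
  generalize (C v' j).c i = z at *
  clear * - h1' h2' hc
  revert x y z
  decide

end Good

/-! ### Closure -/

/-- The ways in which clock `i` of a node `u` with `d_u ≤ i` can move in one step from a legitimate
configuration: wave downwards, wave upwards, reflection at the end of a chain, and increment and
arrow reset at a leader. -/
inductive ClockMove (G : SimpleGraph V) (C : Config V k N) (j : Fin N) (u : V) (i : ClockIdx k)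
    (s' : LocalState k) : Prop
  | stay (hc : s'.c i = (C u j).c i) (hb : s'.b i = (C u j).b i)
  | down (h0 : 0 < dist C j u) (hu : (C u j).b i = .up)
      (hp : ∀ p, Parent G C j u p → (C p j).c i = (C u j).c i + 1 ∧ (C p j).b i = .down)
      (hc : s'.c i = (C u j).c i + 1) (hb : s'.b i = .down)
  | up (h0 : 0 < dist C j u) (hi : dist C j u < (i : ℕ)) (hu : (C u j).b i = .down)
      (hv : ∀ v, Child G C j u v → (C v j).c i = (C u j).c i ∧ (C v j).b i = .up)
      (hc : s'.c i = (C u j).c i) (hb : s'.b i = .up)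
  | endNew (h0 : 0 < dist C j u) (hi : dist C j u = (i : ℕ))
      (hp : ∀ p, Parent G C j u p → (C p j).c i = (C u j).c i + 1 ∧ (C p j).b i = .down)
      (hc : s'.c i = (C u j).c i + 1) (hb : s'.b i = .up)
  | endOld (h0 : 0 < dist C j u) (hi : dist C j u = (i : ℕ)) (hu : (C u j).b i = .down)
      (hp : ∀ p, Parent G C j u p → (C p j).c i = (C u j).c i ∧ (C p j).b i = .down)
      (hc : s'.c i = (C u j).c i) (hb : s'.b i = .up)
  | incr (h0 : dist C j u = 0) (hu : (C u j).b i = .down)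
      (hv : ∀ v, Child G C j u v → (C v j).c i = (C u j).c i ∧ (C v j).b i = .up)
      (hc : s'.c i = (C u j).c i + 1) (hb : s'.b i = .down)
  | leaderDown (h0 : dist C j u = 0) (hc : s'.c i = (C u j).c i) (hb : s'.b i = .down)

/-- Coherence of a node `u` with a parent `p` is kept when both move at the same time. -/
lemma CohPair.move {G : SimpleGraph V} {C : Config V k N} {j : Fin N} {u p : V} {i : ClockIdx k}
    {s t : LocalState k} (hp : Parent G C j u p) (hi : dist C j u ≤ (i : ℕ))
    (h : CohPair i (C u j) (C p j)) (hu : ClockMove G C j u i s) (ht : ClockMove G C j p i t) :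
    CohPair i s t := by
  have hd := hp.2
  have hch : Child G C j p u := ⟨hp.1.symm, hd.symm⟩
  have h1 : (1 : ZMod 4) ≠ 0 := by decide
  have h2 : (1 + 1 : ZMod 4) ≠ 0 := by decide
  unfold CohPair at *
  cases hu with
  | stay hc hb =>
    cases ht with
    | stay hc' hb' => simpa [hc, hb, hc', hb'] using h
    | down h0 hb0 hp' hc' hb' =>
      rcases h with h | h | h | h <;> simp_all
    | up h0 hi' hb0 hv hc' hb' =>
      have := hv u hch
      simp_all
    | endNew h0 hi' => omega
    | endOld h0 hi' => omega
    | incr h0 hb0 hv hc' hb' =>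
      have := hv u hch
      simp_all
    | leaderDown h0 hc' hb' =>
      rcases h with h | h | h | h <;> simp_all
  | down h0 hb0 hp' hc hb =>
    have hpp := hp' p hp
    cases ht with
    | stay hc' hb' => simp_all
    | down h0' hb0' hp'' hc' hb' => simp_all
    | up h0' hi' hb0' hv hc' hb' =>
      have := hv u hch
      exact absurd (hpp.1.symm.trans this.1.symm) (by simp [h1])
    | endNew h0 hi' => omega
    | endOld h0 hi' => omega
    | incr h0' hb0' hv hc' hb' =>
      have := hv u hch
      exact absurd (hpp.1.symm.trans this.1.symm) (by simp [h1])
    | leaderDown h0' hc' hb' => simp_all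
  | up h0 hi' hb0 hv hc hb =>
    cases ht with
    | stay hc' hb' => rcases h with h | h | h | h <;> simp_all
    | down h0' hb0' hp'' hc' hb' => rcases h with h | h | h | h <;> simp_all
    | up h0' hi'' hb0' hv' hc' hb' =>
      have := hv' u hch
      simp_all
    | endNew h0 hi' => omega
    | endOld h0 hi' => omega
    | incr h0' hb0' hv' hc' hb' =>
      have := hv' u hch
      simp_all
    | leaderDown h0' hc' hb' => rcases h with h | h | h | h <;> simp_all
  | endNew h0 hi' hp' hc hb =>
    have hpp := hp' p hp
    cases ht with
    | stay hc' hb' => simp_all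
    | down h0' hb0' hp'' hc' hb' => simp_all
    | up h0' hi'' hb0' hv hc' hb' =>
      have := hv u hch
      exact absurd (hpp.1.symm.trans this.1.symm) (by simp [h1])
    | endNew h0 hi' => omega
    | endOld h0 hi' => omega
    | incr h0' hb0' hv hc' hb' =>
      have := hv u hch
      exact absurd (hpp.1.symm.trans this.1.symm) (by simp [h1])
    | leaderDown h0' hc' hb' => simp_all
  | endOld h0 hi' hb0 hp' hc hb =>
    have hpp := hp' p hp
    cases ht with
    | stay hc' hb' => simp_all
    | down h0' hb0' hp'' hc' hb' => simp_all
    | up h0' hi'' hb0' hv hc' hb' =>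
      have := hv u hch
      simp [hb0] at this
    | endNew h0 hi' => omega
    | endOld h0 hi' => omega
    | incr h0' hb0' hv hc' hb' =>
      have := hv u hch
      simp [hb0] at this
    | leaderDown h0' hc' hb' => simp_all
  | incr h0 => omega
  | leaderDown h0 => omega

section Closure

variable {G : SimpleGraph V} {C C' : Config V k N} {j : Fin N} {u v s t : V} {n : ℕ}

lemma Legit.not_becomeLeader (h : Legit G C j) (hk : 2 < k) : ¬ Guard G C j u .becomeLeader := by
  rintro ⟨_, hd, hv, hu⟩
  obtain ⟨s, hs, hus⟩ := h.covered u hu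
  have hn : Near G (1 + (k - 2)) u s := near_of_edist_lt (by rwa [show 1 + (k - 2) + 1 = k by omega])
  obtain ⟨w, hw, hws⟩ := hn.split
  have h1 := h.good.stable.dist_le_of_near hs hws
  rcases near_one.1 hw with hw | rfl
  · have := hv w hw
    omega
  · omega

/-- In a legitimate configuration, the only effect of a rule is a move of some clocks. -/
lemma Legit.command (h : Legit G C j) (hk : 2 < k) {R : Rule} {s' : LocalState k}
    (hR : Eligible G C j u R) (hc : Command G C j u R s') :
    s'.d = (C u j).d ∧ s'.err = false ∧
      ∀ i : ClockIdx k, dist C j u ≤ (i : ℕ) → ClockMove G C j u i s' := by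
  have he := h.good.noErr
  have hg := hR.1
  cases R with
  | incrLeader =>
    obtain ⟨h1, h2, h3, h4⟩ := hc
    refine ⟨h1, h2.trans (he u), fun i _ => ?_⟩
    have hb : (C u j).b i = .down := by
      cases hb : (C u j).b i with
      | down => rfl
      | up =>
        -- otherwise the rule that resets the arrows of a leader takes precedence
        have := hR.2 .leaderDown ⟨hg.1, hg.2.1, i, hb⟩
        simp [Rule.priority] at this
    have h4 := h4 i
    split_ifs at h4 with hi
    · refine .incr hg.2.1 hb (fun v hv => ?_) h4 (by rw [h3, hb])
      have := hi v hv.1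
      exact ⟨(sub_eq_zero.1 this.2.1).symm, this.2.2⟩
    · exact .stay h4 (by rw [h3])
  | syncOneDown =>
    obtain ⟨h1, h2, v, hv, _, h4⟩ := hc
    refine ⟨h1, h2.trans (he u), fun i _ => ?_⟩
    have h4 := h4 i
    split_ifs at h4 with hi
    · obtain ⟨hu, hv0, hcv, hb⟩ := hi
      have hcv' : (C v j).c i = (C u j).c i + 1 := by rw [hcv]; ring
      refine .down (by omega) hb (fun p hp => ?_) (h4.1.trans hcv') h4.2
      have hp0 : dist C j p = 0 := by
        have := hp.2
        omega
      have hpv : p = v := h.good.eq_of_near hp0 hv0 (by omega : 1 + 1 < k)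
        ((Near.of_adj hp.1).symm.trans (Near.of_adj hv))
      subst hpv
      -- a leader whose arrow points up has only nodes with the same clock value as children
      have hcoh := h.good.coherent u p hp i (by rw [hu]; exact (Finset.mem_Icc.1 i.2).1)
      refine ⟨hcv', ?_⟩
      have h1 : (1 : ZMod 4) ≠ 0 := by decide
      rcases hcoh with ⟨_, _, c⟩ | ⟨_, b, _⟩ | ⟨_, b, _⟩ | ⟨_, b, _⟩
      · exact absurd (c.symm.trans hcv') (by simp [h1])
      all_goals exact b
    · exact .stay h4.1 h4.2
  | syncTwoDown =>
    obtain ⟨h1, h2, v, hv, h4⟩ := hc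
    refine ⟨h1, h2.trans (he u), fun i _ => ?_⟩
    have h4 := h4 i
    split_ifs at h4 with hi
    · obtain ⟨_, hb, hp⟩ := hi
      have hp' : ∀ p, Parent G C j u p →
          (C p j).c i = (C u j).c i + 1 ∧ (C p j).b i = .down := by
        intro p hpp
        refine ⟨?_, (hp p hpp).2⟩
        rw [(hp p hpp).1]
        ring
      exact .down (by have := hg.2.1; omega) hb hp' (h4.1.trans (hp' v hv).1) h4.2
    · exact .stay h4.1 h4.2
  | syncUp =>
    obtain ⟨h1, h2, h3, h4⟩ := hc
    refine ⟨h1, h2.trans (he u), fun i _ => ?_⟩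
    have h4 := h4 i
    split_ifs at h4 with hi
    · exact .up hg.2.1 hi.1 hi.2.1 (fun v hv => ⟨(hi.2.2 v hv).1.symm, (hi.2.2 v hv).2⟩)
        (by rw [h3]) h4
    · exact .stay (by rw [h3]) h4
  | syncEnd =>
    obtain ⟨h1, h2, v, hv, h4⟩ := hc
    refine ⟨h1, h2.trans (he u), fun i _ => ?_⟩
    have h4 := h4 i
    split_ifs at h4 with hi
    · obtain ⟨hi, hp | ⟨hb, hp⟩⟩ := hi
      · have hp' : ∀ p, Parent G C j u p →
            (C p j).c i = (C u j).c i + 1 ∧ (C p j).b i = .down := by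
          intro p hpp
          refine ⟨?_, (hp p hpp).2⟩
          rw [(hp p hpp).1]
          ring
        exact .endNew hg.2.1 hi.symm hp' (h4.1.trans (hp' v hv).1) h4.2
      · exact .endOld hg.2.1 hi.symm hb (fun p hpp => ⟨(hp p hpp).1.symm, (hp p hpp).2⟩)
          (h4.1.trans (hp v hv).1.symm) h4.2
    · exact .stay h4.1 h4.2
  | updateDistance => exact absurd hg h.good.stable.not_updateDistance
  | becomeLeader => exact absurd hg (h.not_becomeLeader hk)
  | leaderDown =>
    obtain ⟨h1, h2, h3, h4⟩ := hc
    exact ⟨h1, h2.trans (he u), fun i _ => .leaderDown hg.2.1 (by rw [h3]) (h4 i)⟩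
  | twoHeads => exact absurd hg (h.good.not_twoHeads hk)
  | branchIncoherence => exact absurd hg h.good.not_branchIncoherence
  | remoteCollision => exact absurd hg (h.good.not_remoteCollision hk)
  | errorSpread =>
    obtain ⟨_, _, v, _, hv, _⟩ := hg
    simp [he v] at hv
  | resetError => simp [Guard, he u] at hg
  | belongToTwo => exact absurd hg h.good.stable.not_belongToTwo

lemma parent_congr (hd : ∀ u, dist C' j u = dist C j u) :
    Parent G C' j u v ↔ Parent G C j u v := by
  simp [Parent, hd]

lemma targetDist_congr (hd : ∀ u, dist C' j u = dist C j u) :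
    targetDist G C' j u = targetDist G C j u := by
  simp [targetDist, hd]

lemma Stable.congr (h : Stable G C j) (hd : ∀ u, dist C' j u = dist C j u)
    (hl : ∀ u, LowerLeader C' j u ↔ LowerLeader C j u) : Stable G C' j where
  unblocked u hu := by
    rw [hd] at hu
    rw [hl]
    exact h.unblocked u hu
  eq_target u hu := by
    rw [hd] at hu
    rw [hd, targetDist_congr hd]
    exact h.eq_target u hu

lemma leaders_congr (hd : ∀ u, dist C' j u = dist C j u) : leaders C' j = leaders C j := by
  simp [leaders, hd]

lemma Legit.step_cases (h : Legit G C j) (hk : 2 < k) (hs : Step G C C') (u : V) :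
    (C' u j).d = (C u j).d ∧ (C' u j).err = false ∧
      ∀ i : ClockIdx k, dist C j u ≤ (i : ℕ) → ClockMove G C j u i (C' u j) := by
  obtain ⟨A, _, _, hA, hA'⟩ := hs
  have hstay : C' u j = C u j → (C' u j).d = (C u j).d ∧ (C' u j).err = false ∧
      ∀ i : ClockIdx k, dist C j u ≤ (i : ℕ) → ClockMove G C j u i (C' u j) := by
    intro e
    rw [e]
    exact ⟨rfl, h.good.noErr u, fun i _ => .stay rfl rfl⟩
  by_cases hu : u ∈ A
  · rcases hA' u hu j with ⟨R, hR, hc⟩ | ⟨_, e⟩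
    · exact h.command hk hR hc
    · exact hstay e
  · exact hstay (by rw [hA u hu])

lemma Legit.step_dist (h : Legit G C j) (hk : 2 < k) (hs : Step G C C') (u : V) :
    dist C' j u = dist C j u := by
  simp only [dist, (h.step_cases hk hs u).1]

lemma Legit.step (h : Legit G C j) (hk : 2 < k) (hs : Step G C C')
    (hl : ∀ u, LowerLeader C' j u ↔ LowerLeader C j u) : Legit G C' j := by
  have hd := h.step_dist hk hs
  refine ⟨⟨h.good.stable.congr hd hl, fun u => (h.step_cases hk hs u).2.1, ?_, ?_⟩, ?_⟩
  · intro u p hp i hi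
    rw [parent_congr hd] at hp
    rw [hd] at hi
    have := hp.2
    exact (h.good.coherent u p hp i hi).move hp hi ((h.step_cases hk hs u).2.2 i hi)
      ((h.step_cases hk hs p).2.2 i (by omega))
  · rw [leaders_congr hd]
    exact h.good.separated
  · intro u hu
    rw [hl] at hu
    rw [leaders_congr hd]
    exact h.covered u hu

/-- The first `n` algorithms are in a legitimate configuration. -/
def LegitBelow (G : SimpleGraph V) (n : ℕ) (C : Config V k N) : Prop :=
  ∀ p : Fin N, (p : ℕ) < n → Legit G C p

/-- `C'` can be reached from `C`. -/
abbrev Reach (G : SimpleGraph V) : Config V k N → Config V k N → Prop :=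
  Relation.ReflTransGen (Step G)

lemma LegitBelow.step_dist (h : LegitBelow G n C) (hk : 2 < k) (hs : Step G C C') {p : Fin N}
    (hp : (p : ℕ) < n) (u : V) : dist C' p u = dist C p u :=
  (h p hp).step_dist hk hs u

lemma LegitBelow.step_lowerLeader (h : LegitBelow G n C) (hk : 2 < k) (hs : Step G C C')
    (hj : (j : ℕ) ≤ n) (u : V) : LowerLeader C' j u ↔ LowerLeader C j u := by
  refine exists_congr fun p => and_congr_right fun hp => ?_
  rw [h.step_dist hk hs (lt_of_lt_of_le hp hj)]

lemma LegitBelow.step (h : LegitBelow G n C) (hk : 2 < k) (hs : Step G C C') :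
    LegitBelow G n C' := fun p hp =>
  (h p hp).step hk hs (h.step_lowerLeader hk hs hp.le)

lemma LegitBelow.reach (h : LegitBelow G n C) (hk : 2 < k) (hs : Reach G C C') :
    LegitBelow G n C' ∧ (∀ p : Fin N, (p : ℕ) < n → ∀ u, dist C' p u = dist C p u) ∧
      ∀ j : Fin N, (j : ℕ) ≤ n → ∀ u, LowerLeader C' j u ↔ LowerLeader C j u := by
  induction hs with
  | refl => exact ⟨h, fun _ _ _ => rfl, fun _ _ _ => Iff.rfl⟩
  | tail _ hs ih =>
    exact ⟨ih.1.step hk hs, fun p hp u => (ih.1.step_dist hk hs hp u).trans (ih.2.1 p hp u),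
      fun j hj u => (ih.1.step_lowerLeader hk hs hj u).trans (ih.2.2 j hj u)⟩

end Closure

/-! ### Losing a leader -/

section Lose

variable {G : SimpleGraph V} {C C' : Config V k N} {j : Fin N} {u v s t : V} {n : ℕ}

/-- If the algorithms before `j` are legitimate, a rule of algorithm `j` which is eligible at `u` can
be executed without changing algorithm `j` at other nodes, nor the set of blocked nodes. -/
lemma LegitBelow.exec (h : LegitBelow G j C) (hk : 2 < k) {R : Rule} (hR : Eligible G C j u R) :
    ∃ C', Reach G C C' ∧ LegitBelow G j C' ∧ (∀ w, LowerLeader C' j w ↔ LowerLeader C j w) ∧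
      Command G C j u R (C' u j) ∧ ∀ v, v ≠ u → C' v j = C v j := by
  obtain ⟨s', hs'⟩ := exists_command G C j hk u R hR.1
  obtain ⟨C', hstep, hu, hv⟩ := exists_step G C j hk u R s' hR hs'
  have hr : Reach G C C' := Relation.ReflTransGen.single hstep
  refine ⟨C', hr, (h.reach hk hr).1, (h.reach hk hr).2.2 j le_rfl, hu ▸ hs', fun v hv' => ?_⟩
  rw [hv v hv']

/-- Algorithm `j` can reach a configuration with fewer leaders. -/
def CanLose (G : SimpleGraph V) (C : Config V k N) (j : Fin N) : Prop :=
  ∃ C', Reach G C C' ∧ (leaders C' j).ncard < (leaders C j).ncard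

lemma CanLose.of_reach (h : CanLose G C' j) (hr : Reach G C C')
    (hl : (leaders C' j).ncard ≤ (leaders C j).ncard) : CanLose G C j := by
  obtain ⟨D, hD, hlt⟩ := h
  exact ⟨D, hr.trans hD, lt_of_lt_of_le hlt hl⟩

lemma CanLose.of_reach_dist (h : CanLose G C' j) (hr : Reach G C C')
    (hd : ∀ u, dist C' j u = dist C j u) : CanLose G C j :=
  h.of_reach hr (by rw [leaders_congr hd])

lemma dist_eq_of_ne (h : C' v j = C v j) : dist C' j v = dist C j v := by
  simp [dist, h]

lemma canLose_of_reach [Finite V] (hr : Reach G C C') (hu : dist C j u = 0)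
    (hu' : dist C' j u ≠ 0) (hv : ∀ v, v ≠ u → C' v j = C v j) : CanLose G C j := by
  refine ⟨C', hr, Set.ncard_lt_ncard ⟨?_, ?_⟩ (Set.toFinite _)⟩
  · intro w hw
    have hwu : w ≠ u := by
      rintro rfl
      exact hu' hw
    exact (dist_eq_of_ne (hv w hwu)).symm.trans hw
  · intro hsub
    exact hu' (hsub hu)

lemma canLose_of_blocked [Finite V] (h : LegitBelow G j C) (hk : 2 < k) (hu : dist C j u = 0)
    (hb : LowerLeader C j u) : CanLose G C j := by
  obtain ⟨C', hr, _, _, hc, hv⟩ := h.exec hk (u := u) (R := .belongToTwo)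
    ⟨⟨hu, hb⟩, fun _ _ => Nat.zero_le _⟩
  refine canLose_of_reach hr hu ?_ hv
  have : dist C' j u = 1 := hc.1
  omega

lemma Stable.eligible_resetError (h : Stable G C j) (he : (C u j).err = true)
    (hg : Guard G C j u .resetError) : Eligible G C j u .resetError := by
  refine ⟨hg, fun R' hR' => ?_⟩
  cases R' with
  | updateDistance => exact absurd hR' h.not_updateDistance
  | belongToTwo => exact absurd hR' h.not_belongToTwo
  | becomeLeader => simp [Guard, he] at hR'
  | leaderDown => simp [Guard, WellDefined, he] at hR'
  | twoHeads => simp [Guard, he] at hR'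
  | branchIncoherence => simp [Guard, he] at hR'
  | remoteCollision => simp [Guard, he] at hR'
  | _ => simp [Rule.priority]

/-- A node of level less than `⌊k/2⌋` with a child in error state can be brought into error state.
If the node is a leader, the reset of its arrows may take precedence; this is why that rule is
excluded here and executed separately. -/
lemma Stable.infect_aux (h : Stable G C j) (hB : LegitBelow G j C) (hk : 2 < k)
    (hv : dist C j v ≤ k / 2 - 1) (ha : G.Adj v u) (hu : (C u j).err = true)
    (hd : dist C j v < dist C j u) (he : (C v j).err = false)
    (hl : ¬ Guard G C j v .leaderDown) :
    ∃ C', Reach G C C' ∧ (∀ w, dist C' j w = dist C j w) ∧ (C' v j).err = true := by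
  have hg : Guard G C j v .errorSpread := ⟨he, hv, u, ha, hu, hd⟩
  have key : ∀ R, Eligible G C j v R →
      (∀ s', Command G C j v R s' → s'.d = (C v j).d ∧ s'.err = true) →
      ∃ C', Reach G C C' ∧ (∀ w, dist C' j w = dist C j w) ∧ (C' v j).err = true := by
    intro R hR hcmd
    obtain ⟨C', hr, _, _, hc, hw⟩ := hB.exec hk hR
    refine ⟨C', hr, fun w => ?_, (hcmd _ hc).2⟩
    by_cases hwv : w = v
    · subst hwv
      simp [dist, (hcmd _ hc).1]
    · exact dist_eq_of_ne (hw w hwv)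
  obtain ⟨R, hR⟩ := exists_eligible G C j v ⟨_, hg⟩
  have hspread : 2 ≤ R.priority →
      ∃ C', Reach G C C' ∧ (∀ w, dist C' j w = dist C j w) ∧ (C' v j).err = true := fun h2 =>
    key .errorSpread ⟨hg, fun R' hR' => h2.trans (hR.2 R' hR')⟩ fun s' hs' => ⟨hs'.1, hs'.2.1⟩
  cases R with
  | updateDistance => exact absurd hR.1 h.not_updateDistance
  | belongToTwo => exact absurd hR.1 h.not_belongToTwo
  | becomeLeader =>
    have := hR.1.2.1
    omega
  | leaderDown => exact absurd hR.1 hl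
  | twoHeads => exact key _ hR fun s' hs' => ⟨hs'.1, hs'.2.1⟩
  | branchIncoherence => exact key _ hR fun s' hs' => ⟨hs'.1, hs'.2.1⟩
  | remoteCollision => exact key _ hR fun s' hs' => ⟨hs'.1, hs'.2.1⟩
  | _ => exact hspread (by simp [Rule.priority])

lemma Stable.eligible_leaderDown (h : Stable G C j) (hg : Guard G C j u .leaderDown) :
    Eligible G C j u .leaderDown := by
  refine ⟨hg, fun R' hR' => ?_⟩
  cases R' with
  | updateDistance => exact absurd hR' h.not_updateDistance
  | belongToTwo => exact absurd hR' h.not_belongToTwo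
  | _ => simp [Rule.priority]

lemma Stable.infect (h : Stable G C j) (hB : LegitBelow G j C) (hk : 2 < k)
    (hv : dist C j v ≤ k / 2 - 1) (ha : G.Adj v u) (hu : (C u j).err = true)
    (hd : dist C j v < dist C j u) (he : (C v j).err = false) :
    ∃ C', Reach G C C' ∧ (∀ w, dist C' j w = dist C j w) ∧ (C' v j).err = true := by
  by_cases hl : Guard G C j v .leaderDown
  · obtain ⟨C', hr, hB', hlow, hc, hw⟩ := hB.exec hk (h.eligible_leaderDown hl)
    have hd' : ∀ w, dist C' j w = dist C j w := by
      intro w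
      by_cases hwv : w = v
      · subst hwv
        simp [dist, hc.1]
      · exact dist_eq_of_ne (hw w hwv)
    have hl' : ¬ Guard G C' j v .leaderDown := by
      rintro ⟨_, _, i, hi⟩
      rw [hc.2.2.2 i] at hi
      exact absurd hi (by simp)
    obtain ⟨D, hD, hdD, heD⟩ := (h.congr hd' hlow).infect_aux hB' hk (by rwa [hd']) ha
      (by rw [hw u ha.ne']; exact hu) (by rw [hd', hd']; exact hd)
      (by rw [hc.2.1]; exact he) hl'
    exact ⟨D, hr.trans hD, fun w => (hdD w).trans (hd' w), heD⟩
  · exact h.infect_aux hB hk hv ha hu hd he hl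

/-- An error at a node of level at most `⌊k/2⌋` can spread towards a leader, which then resigns. -/
lemma Stable.canLose_of_err [Finite V] (h : Stable G C j) (hB : LegitBelow G j C) (hk : 2 < k)
    (hu : dist C j u ≤ k / 2) (he : (C u j).err = true) : CanLose G C j := by
  generalize hn : dist C j u = n at hu
  induction n generalizing C u with
  | zero =>
    obtain ⟨C', hr, _, _, hc, hv⟩ := hB.exec hk (h.eligible_resetError he
      ⟨he, Or.inr fun v _ => Or.inl (by omega)⟩)
    refine canLose_of_reach hr hn ?_ hv
    have hc' := hc.2
    rw [if_pos hn] at hc'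
    have : dist C' j u = 1 := hc'.1
    omega
  | succ n ih =>
    obtain ⟨v, hv, hvd⟩ := h.exists_parent (u := u) (by omega) (by omega)
    cases hev : (C v j).err with
    | true => exact ih h hB hev (by omega) (by omega)
    | false =>
      obtain ⟨C', hr, hd, he'⟩ := h.infect hB hk (by omega) hv.symm he (by omega) hev
      have hB' := hB.reach hk hr
      refine CanLose.of_reach_dist (ih (h.congr hd (hB'.2.2 j le_rfl)) hB'.1 he' ?_ ?_) hr hd
      · rw [hd]
        omega
      · omega

lemma Stable.canLose_of_guard [Finite V] (h : Stable G C j) (hB : LegitBelow G j C) (hk : 2 < k)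
    {R : Rule} (hp : R.priority = 1) (hg : Guard G C j u R) (hu : dist C j u ≤ k / 2)
    (hcmd : ∀ s', Command G C j u R s' → s'.d = (C u j).d ∧ s'.err = true) : CanLose G C j := by
  have hR : Eligible G C j u R := by
    refine ⟨hg, fun R' hR' => ?_⟩
    cases R' with
    | updateDistance => exact absurd hR' h.not_updateDistance
    | belongToTwo => exact absurd hR' h.not_belongToTwo
    | _ => rw [hp]; simp [Rule.priority]
  obtain ⟨C', hr, hB', hlow, hc, hw⟩ := hB.exec hk hR
  have hd : ∀ w, dist C' j w = dist C j w := by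
    intro w
    by_cases hwv : w = u
    · subst hwv
      simp [dist, (hcmd _ hc).1]
    · exact dist_eq_of_ne (hw w hwv)
  exact ((h.congr hd hlow).canLose_of_err hB' hk (by rwa [hd]) (hcmd _ hc).2).of_reach_dist hr hd

end Lose

/-! ### Reaching stable configurations -/

section Update

variable {G : SimpleGraph V} {C C' : Config V k N} {j : Fin N} {u v s t : V} {n : ℕ}

lemma LegitBelow.exec_update (h : LegitBelow G j C) (hk : 2 < k) (h0 : dist C j u ≠ 0)
    (hne : dist C j u ≠ targetDist G C j u) :
    ∃ C', Reach G C C' ∧ LegitBelow G j C' ∧ (∀ w, LowerLeader C' j w ↔ LowerLeader C j w) ∧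
      Command G C j u .updateDistance (C' u j) ∧ (∀ v, v ≠ u → C' v j = C v j) ∧
      leaders C' j = leaders C j := by
  obtain ⟨C', hr, hB, hlow, hc, hv⟩ := h.exec hk (u := u) (R := .updateDistance)
    ⟨⟨h0, hne⟩, fun _ _ => Nat.zero_le _⟩
  refine ⟨C', hr, hB, hlow, hc, hv, ?_⟩
  ext w
  show dist C' j w = 0 ↔ dist C j w = 0
  by_cases hw : w = u
  · subst hw
    have h1 : dist C' j w = targetDist G C j w := hc.1
    have := one_le_targetDist G C j hk w
    omega
  · rw [dist_eq_of_ne (hv w hw)]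

/-- Distances which are too small can be raised. -/
lemma LegitBelow.exists_target_le [Fintype V] (h : LegitBelow G j C) (hk : 2 < k) :
    ∃ C', Reach G C C' ∧ leaders C' j = leaders C j ∧
      ∀ u, dist C' j u ≠ 0 → targetDist G C' j u ≤ dist C' j u := by
  induction hm : ∑ u, (k - dist C j u) using Nat.strong_induction_on generalizing C with
  | _ m ih =>
    by_cases hex : ∃ u, dist C j u ≠ 0 ∧ dist C j u < targetDist G C j u
    · obtain ⟨u, h0, hlt⟩ := hex
      obtain ⟨C', hr, hB, _, hc, hv, hl⟩ := h.exec_update hk h0 hlt.ne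
      have h1 : dist C' j u = targetDist G C j u := hc.1
      have hsum : ∑ w, (k - dist C' j w) < m := by
        rw [← hm]
        refine Finset.sum_lt_sum (fun w _ => ?_) ⟨u, Finset.mem_univ _, ?_⟩
        · by_cases hw : w = u
          · subst hw
            omega
          · rw [dist_eq_of_ne (hv w hw)]
        · have := dist_lt C j u
          omega
      obtain ⟨D, hD, hlD, hD'⟩ := ih _ hsum hB rfl
      exact ⟨D, hr.trans hD, hlD.trans hl, hD'⟩
    · push Not at hex
      exact ⟨C, .refl, rfl, hex⟩

lemma targetDist_mono (hd : ∀ w, dist C' j w ≤ dist C j w) :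
    targetDist G C' j u ≤ targetDist G C j u := by
  rcases targetDist_cases G C j u with h' | ⟨v, hv, h'⟩
  · rw [h']
    exact targetDist_le_pred G C' j u
  · have := targetDist_le C' j hv
    have := hd v
    omega

/-- Distances which are too large can be lowered; the invariant `P` is kept if every such update
keeps it. -/
lemma LegitBelow.exists_target_eq [Fintype V] (P : Config V k N → Prop)
    (hP : ∀ C C' : Config V k N, ∀ u, P C → dist C j u ≠ 0 → targetDist G C j u < dist C j u →
      Command G C j u .updateDistance (C' u j) → (∀ v, v ≠ u → C' v j = C v j) → P C')
    (h : LegitBelow G j C) (hk : 2 < k) (hC : P C)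
    (hle : ∀ u, dist C j u ≠ 0 → targetDist G C j u ≤ dist C j u) :
    ∃ C', Reach G C C' ∧ leaders C' j = leaders C j ∧ P C' ∧
      ∀ u, dist C' j u ≠ 0 → dist C' j u = targetDist G C' j u := by
  induction hm : ∑ u, dist C j u using Nat.strong_induction_on generalizing C with
  | _ m ih =>
    by_cases hex : ∃ u, dist C j u ≠ 0 ∧ dist C j u ≠ targetDist G C j u
    · obtain ⟨u, h0, hne⟩ := hex
      obtain ⟨C', hr, hB, _, hc, hv, hl⟩ := h.exec_update hk h0 hne
      have h1 : dist C' j u = targetDist G C j u := hc.1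
      have hlt : targetDist G C j u < dist C j u := lt_of_le_of_ne (hle u h0) hne.symm
      have hd : ∀ w, dist C' j w ≤ dist C j w := by
        intro w
        by_cases hw : w = u
        · subst hw
          omega
        · rw [dist_eq_of_ne (hv w hw)]
      have hsum : ∑ w, dist C' j w < m := by
        rw [← hm]
        exact Finset.sum_lt_sum (fun w _ => hd w) ⟨u, Finset.mem_univ _, by omega⟩
      have htar := fun w => targetDist_mono (G := G) (u := w) hd
      obtain ⟨D, hD, hlD, hPD, hD'⟩ := ih _ hsum hB (hP C C' u hC h0 hlt hc hv) (by
        intro w hw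
        by_cases hwu : w = u
        · subst hwu
          rw [h1]
          exact htar w
        · rw [dist_eq_of_ne (hv w hwu)] at hw ⊢
          exact (htar w).trans (hle w hw)) rfl
      exact ⟨D, hr.trans hD, hlD.trans hl, hPD, hD'⟩
    · push Not at hex
      exact ⟨C, .refl, rfl, hC, hex⟩

/-- Errors at nodes of level more than `⌊k/2⌋` can be reset. -/
lemma Stable.exists_noErr [Fintype V] (h : Stable G C j) (hB : LegitBelow G j C) (hk : 2 < k)
    (he : ∀ u, (C u j).err = true → k / 2 < dist C j u) :
    ∃ C', Reach G C C' ∧ (∀ u, dist C' j u = dist C j u) ∧ NoErr C' j := by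
  classical
  induction hm : (Finset.univ.filter fun u => (C u j).err = true).card
    using Nat.strong_induction_on generalizing C with
  | _ m ih =>
    by_cases hex : ∃ u, (C u j).err = true
    · obtain ⟨u, hu⟩ := hex
      obtain ⟨C', hr, hB', hlow, hc, hv⟩ := hB.exec hk
        (h.eligible_resetError hu ⟨hu, Or.inl (he u hu)⟩)
      have hc' := hc.2
      rw [if_neg (by have := he u hu; omega)] at hc'
      have hd : ∀ w, dist C' j w = dist C j w := by
        intro w
        by_cases hw : w = u
        · subst hw
          simp [dist, hc'.1]
        · exact dist_eq_of_ne (hv w hw)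
      have hsub : ∀ w, (C' w j).err = true → w ≠ u ∧ (C w j).err = true := by
        intro w hw
        by_cases hwu : w = u
        · subst hwu
          rw [hc.1] at hw
          exact absurd hw (by simp)
        · rw [hv w hwu] at hw
          exact ⟨hwu, hw⟩
      have hcard : (Finset.univ.filter fun u => (C' u j).err = true).card < m := by
        rw [← hm]
        refine Finset.card_lt_card ⟨fun w hw => ?_, fun hsup => ?_⟩
        · simp only [Finset.mem_filter, Finset.mem_univ, true_and] at hw ⊢
          exact (hsub w hw).2
        · have := hsup (Finset.mem_filter.2 ⟨Finset.mem_univ u, hu⟩)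
          simp only [Finset.mem_filter, Finset.mem_univ, true_and] at this
          exact (hsub u this).1 rfl
      obtain ⟨D, hD, hdD, hnD⟩ := ih _ hcard (h.congr hd hlow) hB'
        (fun w hw => by rw [hd]; exact he w (hsub w hw).2) rfl
      exact ⟨D, hr.trans hD, fun w => (hdD w).trans (hd w), hnD⟩
    · push Not at hex
      exact ⟨C, .refl, fun _ => rfl, fun u => by simpa using hex u⟩

end Update

/-! ### Configurations in which no leader can be lost -/

/-- A stable and error-free configuration in which the set of leaders of algorithm `j` cannot be
made smaller. -/
structure Stuck (G : SimpleGraph V) (C : Config V k N) (j : Fin N) : Prop where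
  below : LegitBelow G j C
  stable : Stable G C j
  noErr : NoErr C j
  noLoss : ¬ CanLose G C j

lemma inClosedNbhd_iff {G : SimpleGraph V} {u v : V} : InClosedNbhd G u v ↔ Near G 1 u v := by
  rw [near_one, InClosedNbhd]
  tauto

section Stuck

variable {G : SimpleGraph V} {C C' : Config V k N} {j : Fin N} {u v s t : V} {n : ℕ}

lemma Stuck.not_twoHeads [Finite V] (h : Stuck G C j) (hk : 2 < k) :
    ¬ Guard G C j u .twoHeads := by
  intro hg
  obtain ⟨_, v, _, hv, _, _, h0, _⟩ := id hg
  have := h.stable.dist_le_of_near h0 (inClosedNbhd_iff.1 hv)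
  exact h.noLoss (h.stable.canLose_of_guard h.below hk rfl hg (by omega)
    fun s' hs' => ⟨hs'.1, hs'.2.1⟩)

lemma Stuck.not_branchIncoherence [Finite V] (h : Stuck G C j) (hk : 2 < k) :
    ¬ Guard G C j u .branchIncoherence := by
  intro hg
  have hu : dist C j u ≤ k / 2 := by
    by_contra hlt
    exact hg.2 (Or.inl (by omega))
  exact h.noLoss (h.stable.canLose_of_guard h.below hk rfl hg hu
    fun s' hs' => ⟨hs'.1, hs'.2.1⟩)

lemma Stuck.not_remoteCollision [Finite V] (h : Stuck G C j) (hk : 2 < k) :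
    ¬ Guard G C j u .remoteCollision := by
  intro hg
  have := hg.2.1
  exact h.noLoss (h.stable.canLose_of_guard h.below hk rfl hg (by omega)
    fun s' hs' => ⟨hs'.1, hs'.2.1⟩)

lemma Stuck.coherent [Finite V] (h : Stuck G C j) (hk : 2 < k) : Coherent G C j := by
  refine forall_branchCoherence_iff.1 fun u => ?_
  by_contra hb
  exact h.not_branchIncoherence hk ⟨h.noErr u, hb⟩

/-- Clock moves lead from stuck configurations to stuck ones; in particular they never break
coherence. -/
lemma Stuck.exec (h : Stuck G C j) (hk : 2 < k) {R : Rule} (hR : Eligible G C j u R)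
    (hcmd : ∀ s', Command G C j u R s' → s'.d = (C u j).d ∧ s'.err = (C u j).err) :
    ∃ C', Reach G C C' ∧ Stuck G C' j ∧ (∀ w, dist C' j w = dist C j w) ∧
      Command G C j u R (C' u j) ∧ ∀ v, v ≠ u → C' v j = C v j := by
  obtain ⟨C', hr, hB', hlow, hc, hw⟩ := h.below.exec hk hR
  have hd : ∀ w, dist C' j w = dist C j w := by
    intro w
    by_cases hwv : w = u
    · subst hwv
      simp [dist, (hcmd _ hc).1]
    · exact dist_eq_of_ne (hw w hwv)
  refine ⟨C', hr, ⟨hB', h.stable.congr hd hlow, fun w => ?_,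
    fun hl => h.noLoss (hl.of_reach_dist hr hd)⟩, hd, hc, hw⟩
  by_cases hwv : w = u
  · subst hwv
    rw [(hcmd _ hc).2]
    exact h.noErr w
  · rw [hw w hwv]
    exact h.noErr w

lemma Stuck.eligible [Finite V] (h : Stuck G C j) (hk : 2 < k) {R : Rule} (hp : R.priority = 2)
    (hg : Guard G C j u R) (hu : dist C j u < k - 1) (hl : ¬ Guard G C j u .leaderDown) :
    Eligible G C j u R := by
  refine ⟨hg, fun R' hR' => ?_⟩
  cases R' with
  | updateDistance => exact absurd hR' h.stable.not_updateDistance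
  | belongToTwo => exact absurd hR' h.stable.not_belongToTwo
  | becomeLeader =>
    have := hR'.2.1
    omega
  | leaderDown => exact absurd hR' hl
  | twoHeads => exact absurd hR' (h.not_twoHeads hk)
  | branchIncoherence => exact absurd hR' (h.not_branchIncoherence hk)
  | remoteCollision => exact absurd hR' (h.not_remoteCollision hk)
  | _ => rw [hp]; simp [Rule.priority]

end Stuck

/-! ### Running one clock in one cell -/

/-- The nodes of level at most `r` whose distance to the leader `s` is their level. -/
def Cell (G : SimpleGraph V) (C : Config V k N) (j : Fin N) (s : V) (r : ℕ) : Set V :=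
  {u | dist C j u ≤ r ∧ Near G (dist C j u) u s}

/-- Every other leader is at distance more than `2 * r` from `s`, so that the cells of radius `r`
around `s` and around any other leader are disjoint. -/
def Isolated (G : SimpleGraph V) (C : Config V k N) (j : Fin N) (s : V) (r : ℕ) : Prop :=
  ∀ t, dist C j t = 0 → Near G (2 * r) s t → t = s

section Cell

variable {G : SimpleGraph V} {C C' : Config V k N} {j : Fin N} {u v s t p : V} {n r : ℕ}

lemma cell_congr (hd : ∀ u, dist C' j u = dist C j u) : Cell G C' j s r = Cell G C j s r := by
  simp [Cell, hd]

lemma Isolated.congr (h : Isolated G C j s r) (hd : ∀ u, dist C' j u = dist C j u) :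
    Isolated G C' j s r := fun t ht => h t (by rwa [← hd])

lemma eq_of_mem_cell (hu : u ∈ Cell G C j s r) (h0 : dist C j u = 0) : u = s := by
  have := hu.2
  rwa [h0, near_zero] at this

lemma child_mem_cell (hu : u ∈ Cell G C j s r)
    (hv : Child G C j u v) (hr : dist C j u < r) : v ∈ Cell G C j s r := by
  have hd := hv.2
  refine ⟨by omega, ?_⟩
  rw [hd, add_comm]
  exact (Near.of_adj hv.1.symm).trans hu.2

lemma Stable.parent_mem_cell (h : Stable G C j) (hI : Isolated G C j s r) (hr : r < k - 1)
    (hu : u ∈ Cell G C j s r) (hp : Parent G C j u p) : p ∈ Cell G C j s r := by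
  have hd := hp.2
  have hur := hu.1
  obtain ⟨t, ht, hpt⟩ := h.exists_leader (u := p) (by omega)
  have : t = s := hI t ht
    ((hu.2.symm.trans ((Near.of_adj hp.1).trans hpt)).mono (by omega))
  exact ⟨by omega, this ▸ hpt⟩

lemma exists_min_of_nat {α : Type*} (f : α → ℕ) (P : α → Prop) (h : ∃ a, P a) :
    ∃ a, P a ∧ ∀ b, P b → f a ≤ f b := by
  classical
  have hex : ∃ n a, P a ∧ f a = n := by
    obtain ⟨a, ha⟩ := h
    exact ⟨_, a, ha, rfl⟩
  obtain ⟨a, ha, hn⟩ := Nat.find_spec hex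
  exact ⟨a, ha, fun b hb => hn ▸ Nat.find_min' hex ⟨b, hb, rfl⟩⟩

lemma Stuck.reset_arrows (h : Stuck G C j) (hk : 2 < k) (hs : dist C j s = 0) :
    ∃ C', Reach G C C' ∧ Stuck G C' j ∧ (∀ w, dist C' j w = dist C j w) ∧
      ∀ i, (C' s j).b i = .down := by
  by_cases hl : Guard G C j s .leaderDown
  · obtain ⟨C', hr, hS, hd, hc, hw⟩ := h.exec hk (h.stable.eligible_leaderDown hl)
      fun s' hs' => ⟨hs'.1, hs'.2.1⟩
    exact ⟨C', hr, hS, hd, hc.2.2.2⟩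
  · refine ⟨C, .refl, h, fun _ => rfl, fun i => ?_⟩
    cases hb : (C s j).b i with
    | down => rfl
    | up => exact absurd ⟨h.stable.wellDefined (h.noErr s) (by omega), hs, i, hb⟩ hl

end Cell

section Wave

variable [Fintype V] {G : SimpleGraph V} {C C' : Config V k N} {j : Fin N} {u v s t p : V} {n : ℕ}

lemma zmod_four_ne_add_one (x : ZMod 4) : x ≠ x + 1 := by
  revert x
  decide

/-- A node behind the clock of its leader whose parents are all up to date can take over the new
clock value. -/
lemma Stuck.wave_down (h : Stuck G C j) (hk : 2 < k) (i : ClockIdx k)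
    (h0 : dist C j u ≠ 0) (hi : dist C j u ≤ (i : ℕ)) (hb : (C u j).b i = .up)
    (hp : ∀ p, Parent G C j u p → (C p j).c i = (C u j).c i + 1 ∧ (C p j).b i = .down) :
    ∃ C', Reach G C C' ∧ Stuck G C' j ∧ (∀ w, dist C' j w = dist C j w) ∧
      (∀ v, v ≠ u → C' v j = C v j) ∧ (C' u j).b i = .down := by
  have hi2 := Finset.mem_Icc.1 i.2
  have hl : ¬ Guard G C j u .leaderDown := fun hg => h0 hg.2.1
  have hwd := h.stable.wellDefined (h.noErr u) (by omega : dist C j u < k - 1)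
  have hp' : ∀ p, Parent G C j u p → (C u j).c i = (C p j).c i - 1 ∧ (C p j).b i = .down := by
    intro p hpp
    refine ⟨?_, (hp p hpp).2⟩
    rw [(hp p hpp).1]
    ring
  obtain ⟨q, hq⟩ := h.stable.exists_parent h0 (by omega)
  by_cases h1 : dist C j u = 1
  · have hq0 : dist C j q = 0 := by
      have := hq.2
      omega
    have huniq : ∀ v, G.Adj u v → dist C j v = 0 → v = q := by
      intro v hv hv0
      by_contra hne
      exact h.not_twoHeads hk (u := u) ⟨h.noErr u, v, q, Or.inr hv, Or.inr hq.1, hne, hv0, hq0⟩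
    have hidx : SyncOneIdx C j u q i := ⟨h1, hq0, (hp' q hq).1, hb⟩
    have hg : Guard G C j u .syncOneDown :=
      ⟨hwd, q, ⟨hq.1, i, hidx⟩, fun v hv => huniq v hv.1 hv.2.choose_spec.2.1⟩
    obtain ⟨C', hr, hS, hd, hc, hw⟩ := h.exec hk (h.eligible hk rfl hg (by omega) hl)
      fun s' hs' => ⟨hs'.1, hs'.2.1⟩
    refine ⟨C', hr, hS, hd, hw, ?_⟩
    obtain ⟨_, _, v, hv, ⟨i', hi'⟩, hcv⟩ := hc
    have := huniq v hv hi'.2.1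
    subst this
    rw [(hcv i).2, if_pos hidx]
  · have hidx : SyncTwoIdx G C j u i := ⟨hi, hb, hp'⟩
    have hg : Guard G C j u .syncTwoDown := ⟨hwd, by omega, by omega, i, hidx⟩
    obtain ⟨C', hr, hS, hd, hc, hw⟩ := h.exec hk (h.eligible hk rfl hg (by omega) hl)
      fun s' hs' => ⟨hs'.1, hs'.2.1⟩
    refine ⟨C', hr, hS, hd, hw, ?_⟩
    obtain ⟨_, _, v, hv, hcv⟩ := hc
    rw [(hcv i).2, if_pos hidx]

/-- A node which is up to date can turn its arrow upwards if it is the end of the chain, or if all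
its children have done so. -/
lemma Stuck.wave_up (h : Stuck G C j) (hk : 2 < k) (i : ClockIdx k)
    (h0 : dist C j u ≠ 0) (hi : dist C j u ≤ (i : ℕ)) (hb : (C u j).b i = .down)
    (hv : dist C j u < (i : ℕ) →
      ∀ v, Child G C j u v → (C u j).c i = (C v j).c i ∧ (C v j).b i = .up) :
    ∃ C', Reach G C C' ∧ Stuck G C' j ∧ (∀ w, dist C' j w = dist C j w) ∧
      (∀ v, v ≠ u → C' v j = C v j) ∧ (C' u j).b i = .up ∧ (C' u j).c i = (C u j).c i := by
  have hi2 := Finset.mem_Icc.1 i.2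
  have hl : ¬ Guard G C j u .leaderDown := fun hg => h0 hg.2.1
  have hwd := h.stable.wellDefined (h.noErr u) (by omega : dist C j u < k - 1)
  rcases hi.lt_or_eq with hlt | heq
  · have hidx : SyncUpIdx G C j u i := ⟨hlt, hb, hv hlt⟩
    have hg : Guard G C j u .syncUp := ⟨hwd, by omega, by omega, i, hidx⟩
    obtain ⟨C', hr, hS, hd, hc, hw⟩ := h.exec hk (h.eligible hk rfl hg (by omega) hl)
      fun s' hs' => ⟨hs'.1, hs'.2.1⟩
    obtain ⟨_, _, hcc, hcb⟩ := hc
    refine ⟨C', hr, hS, hd, hw, ?_, by rw [hcc]⟩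
    rw [hcb i, if_pos hidx]
  · have hp : ∀ p, Parent G C j u p → (C u j).c i = (C p j).c i ∧ (C p j).b i = .down := by
      intro p hp
      rcases h.coherent hk u p hp i hi with hh | hh | hh | hh <;> simp_all
    have hidx : SyncEndIdx G C j u i := ⟨heq.symm, Or.inr ⟨hb, hp⟩⟩
    have hg : Guard G C j u .syncEnd := ⟨hwd, by omega, by omega, i, hidx⟩
    obtain ⟨C', hr, hS, hd, hc, hw⟩ := h.exec hk (h.eligible hk rfl hg (by omega) hl)
      fun s' hs' => ⟨hs'.1, hs'.2.1⟩
    obtain ⟨_, _, v, hv, hcv⟩ := hc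
    refine ⟨C', hr, hS, hd, hw, ?_, ?_⟩
    · rw [(hcv i).2, if_pos hidx]
    · rw [(hcv i).1, if_pos hidx, (hp v hv).1]

open Classical in
/-- The number of moves of clock `i` which separate `u` from the state in which the arrow points up
and the clock agrees with that of the leader `s`. -/
noncomputable def lag (C : Config V k N) (j : Fin N) (s : V) (i : ClockIdx k) (u : V) : ℕ :=
  if (C u j).b i = .down then 1 else if (C u j).c i = (C s j).c i then 0 else 2

/-- The clock value of a leader can be spread over its cell, without any move outside the cell or
at the leader. -/
lemma Stuck.spread_clock (h : Stuck G C j) (hk : 2 < k) (i : ClockIdx k) (hs : dist C j s = 0)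
    (hI : Isolated G C j s i) (hb : (C s j).b i = .down) :
    ∃ C', Reach G C C' ∧ Stuck G C' j ∧ (∀ w, dist C' j w = dist C j w) ∧
      (∀ u, u ∉ Cell G C j s i → C' u j = C u j) ∧ C' s j = C s j ∧
      ∀ u ∈ Cell G C j s i, u ≠ s → (C' u j).b i = .up ∧ (C' u j).c i = (C s j).c i := by
  classical
  have hi2 := Finset.mem_Icc.1 i.2
  induction hm : ∑ u, lag C j s i u using Nat.strong_induction_on generalizing C with
  | _ m ih =>
    -- a move which decreases the lag of one node of the cell suffices
    have key : ∀ u ∈ Cell G C j s i, u ≠ s → ∀ C', Reach G C C' → Stuck G C' j →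
        (∀ w, dist C' j w = dist C j w) → (∀ v, v ≠ u → C' v j = C v j) →
        lag C' j s i u < lag C j s i u →
        ∃ C', Reach G C C' ∧ Stuck G C' j ∧ (∀ w, dist C' j w = dist C j w) ∧
          (∀ u, u ∉ Cell G C j s i → C' u j = C u j) ∧ C' s j = C s j ∧
          ∀ u ∈ Cell G C j s i, u ≠ s → (C' u j).b i = .up ∧ (C' u j).c i = (C s j).c i := by
      intro u hu hus C' hr hS hd hw hlag
      have hsum : ∑ w, lag C' j s i w < m := by
        rw [← hm]
        refine Finset.sum_lt_sum (fun w _ => ?_) ⟨u, Finset.mem_univ _, hlag⟩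
        by_cases hwu : w = u
        · subst hwu
          exact hlag.le
        · simp only [lag, hw w hwu, hw s hus.symm, le_refl]
      have hs' : C' s j = C s j := hw s hus.symm
      obtain ⟨D, hD, hSD, hdD, hoD, hsD, hcD⟩ := ih _ hsum hS (by rw [hd]; exact hs)
        (hI.congr hd) (by rw [hs']; exact hb) rfl
      rw [cell_congr hd] at hoD hcD
      refine ⟨D, hr.trans hD, hSD, fun w => (hdD w).trans (hd w), fun w hw' => ?_,
        hsD.trans hs', ?_⟩
      · rw [hoD w hw']
        exact hw w fun e => hw' (e ▸ hu)
      · rw [hs'] at hcD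
        exact hcD
    have hcell : ∀ u ∈ Cell G C j s i, _ := fun u hu =>
      h.stable.clock_cell (h.coherent hk) hs i hu.2 hu.1
    by_cases hA : ∃ u, u ∈ Cell G C j s i ∧ (C u j).b i = .up ∧
        (C s j).c i = (C u j).c i + 1
    · obtain ⟨u, ⟨hu, hub, huc⟩, hmin⟩ := exists_min_of_nat (dist C j) _ hA
      have hus : u ≠ s := by
        rintro rfl
        rw [hb] at hub
        exact absurd hub (by simp)
      have h0 : dist C j u ≠ 0 := fun h0 => hus (eq_of_mem_cell hu h0)
      obtain ⟨C', hr, hS, hd, hw, hb'⟩ := h.wave_down hk i h0 hu.1 hub (by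
        intro p hp
        have hpc := h.stable.parent_mem_cell hI (by omega) hu hp
        have hpd := hp.2
        rcases h.coherent hk u p hp i hu.1 with ⟨_, hpb, hc⟩ | ⟨_, hpb, hc⟩ | ⟨_, hpb, hc⟩ |
          ⟨hub', _, _⟩
        · have := hmin p ⟨hpc, hpb, by rw [huc, hc]⟩
          omega
        · rcases hcell p hpc with ⟨hpb', _⟩ | ⟨_, _, hc'⟩ | ⟨hpb', _⟩
          · rw [hpb] at hpb'
            exact absurd hpb' (by simp)
          · rw [← hc', hc] at huc
            exact absurd huc (zmod_four_ne_add_one _)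
          · rw [hpb] at hpb'
            exact absurd hpb' (by simp)
        · exact ⟨hc, hpb⟩
        · rw [hub] at hub'
          exact absurd hub' (by simp))
      refine key u hu hus C' hr hS hd hw ?_
      have : (C u j).c i ≠ (C s j).c i := by
        rw [huc]
        exact zmod_four_ne_add_one _
      simp [lag, hb', hub, this]
    · by_cases hB : ∃ u, u ∈ Cell G C j s i ∧ u ≠ s ∧ (C u j).b i = .down
      · obtain ⟨u, ⟨hu, hus, hub⟩, hmax⟩ := exists_min_of_nat (fun u => k - dist C j u) _ hB
        have h0 : dist C j u ≠ 0 := fun h0 => hus (eq_of_mem_cell hu h0)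
        have huc : (C u j).c i = (C s j).c i := by
          rcases hcell u hu with ⟨hub', _⟩ | ⟨_, _, hc⟩ | ⟨hub', _⟩
          · rw [hub] at hub'
            exact absurd hub' (by simp)
          · exact hc
          · rw [hub] at hub'
            exact absurd hub' (by simp)
        obtain ⟨C', hr, hS, hd, hw, hb', hc'⟩ := h.wave_up hk i h0 hu.1 hub (by
          intro hlt v hv
          have hvc := child_mem_cell hu hv hlt
          have hvd := hv.2
          have hvs : v ≠ s := by
            rintro rfl
            omega
          rcases hcell v hvc with ⟨hvb, hc⟩ | ⟨hvb, _⟩ | ⟨hvb, _, hc⟩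
          · exact ⟨by rw [huc, hc], hvb⟩
          · have := hmax v ⟨hvc, hvs, hvb⟩
            have := dist_lt C j v
            omega
          · exact absurd ⟨v, hvc, hvb, hc⟩ hA)
        refine key u hu hus C' hr hS hd hw ?_
        simp [lag, hb', hub, hc', huc, hw s hus.symm]
      · refine ⟨C, .refl, h, fun _ => rfl, fun _ _ => rfl, rfl, fun u hu hus => ?_⟩
        rcases hcell u hu with hc | ⟨hub, _⟩ | ⟨hub, _, hc⟩
        · exact hc
        · exact absurd ⟨u, hu, hus, hub⟩ hB
        · exact absurd ⟨u, hu, hub, hc⟩ hA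

/-- The clock of a leader can be increased by any amount, without any move outside its cell. -/
lemma Stuck.advance_clock (h : Stuck G C j) (hk : 2 < k) (i : ClockIdx k) (hs : dist C j s = 0)
    (hI : Isolated G C j s i) (hb : ∀ i, (C s j).b i = .down) (n : ℕ) :
    ∃ C', Reach G C C' ∧ Stuck G C' j ∧ (∀ w, dist C' j w = dist C j w) ∧
      (∀ u, u ∉ Cell G C j s i → C' u j = C u j) ∧
      (∀ u ∈ Cell G C j s i, u ≠ s → (C' u j).c i = (C s j).c i + n) := by
  have hi2 := Finset.mem_Icc.1 i.2
  induction n generalizing C with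
  | zero =>
    obtain ⟨C', hr, hS, hd, ho, hs', hc⟩ := h.spread_clock hk i hs hI (hb i)
    exact ⟨C', hr, hS, hd, ho, fun u hu hus => by simp [(hc u hu hus).2]⟩
  | succ n ih =>
    obtain ⟨C', hr, hS, hd, ho, hs', hc⟩ := h.spread_clock hk i hs hI (hb i)
    have hs0 : dist C' j s = 0 := by rw [hd]; exact hs
    have hb' : ∀ i, (C' s j).b i = .down := by rw [hs']; exact hb
    have hwd := hS.stable.wellDefined (hS.noErr s) (by omega : dist C' j s < k - 1)
    have hidx : IncrIdx G C' j s i := by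
      intro v hv
      have h1 := hS.stable.dist_le_of_near hs0 (Near.of_adj hv.symm)
      have h2 : dist C' j v ≠ 0 := fun hv0 => hS.not_twoHeads hk (u := s)
        ⟨hS.noErr s, s, v, Or.inl rfl, Or.inr hv, hv.ne, hs0, hv0⟩
      have h3 : dist C' j v = 1 := by omega
      have hvc : v ∈ Cell G C j s i := by
        rw [← cell_congr hd]
        exact ⟨by omega, by rw [h3]; exact Near.of_adj hv.symm⟩
      have h4 := hc v hvc hv.ne'
      exact ⟨h3, by rw [hs', h4.2, sub_self], h4.1⟩
    have hl : ¬ Guard G C' j s .leaderDown := by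
      rintro ⟨_, _, i', hi'⟩
      rw [hb' i'] at hi'
      exact absurd hi' (by simp)
    obtain ⟨D, hrD, hSD, hdD, hcD, hwD⟩ := hS.exec hk
      (hS.eligible hk (R := .incrLeader) rfl ⟨hwd, hs0, i, hidx⟩ (by omega) hl)
      fun s' hs' => ⟨hs'.1, hs'.2.1⟩
    have hdD' : ∀ w, dist D j w = dist C j w := fun w => (hdD w).trans (hd w)
    obtain ⟨_, _, hDb, hDc⟩ := hcD
    have hDc' : (D s j).c i = (C s j).c i + 1 := by
      rw [hDc i, if_pos hidx, hs']
    obtain ⟨E, hrE, hSE, hdE, hoE, hcE⟩ := ih hSD (by rw [hdD']; exact hs) (hI.congr hdD')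
      (by rw [hDb]; exact hb')
    rw [cell_congr hdD'] at hoE hcE
    refine ⟨E, (hr.trans hrD).trans hrE, hSE, fun w => (hdE w).trans (hdD' w), ?_, ?_⟩
    · intro u hu
      have hus : u ≠ s := by
        rintro rfl
        refine hu ⟨by omega, Near.refl u⟩
      rw [hoE u hu, hwD u hus, ho u hu]
    · intro u hu hus
      rw [hcE u hu hus, hDc']
      push_cast
      ring

/-- If no leader can be lost, then the leaders are pairwise at distance at least `k`. Otherwise,
take two leaders `s`, `s'` at the least distance `L`, and let `i` be the largest integer less than
`L / 2`. The cells of radius `i` are disjoint, so clock `i` can be run in the cell of `s` alone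
until it differs by two from clock `i` in the cell of `s'`, next to a node which sees both. -/
lemma Stuck.good (h : Stuck G C j) (hk : 2 < k) : Good G C j := by
  classical
  refine ⟨h.stable, h.noErr, h.coherent hk, ?_⟩
  by_contra hsep
  have hex : ∃ L, L < k ∧ ∃ s s', dist C j s = 0 ∧ dist C j s' = 0 ∧ s ≠ s' ∧ Near G L s s' := by
    push Not at hsep
    obtain ⟨s, hs, s', hs', hne, hlt⟩ := hsep
    refine ⟨k - 1, by omega, s, s', hs, hs', hne, near_of_edist_lt ?_⟩
    rwa [show k - 1 + 1 = k by omega]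
  obtain ⟨hLk, s, s', hs, hs', hne, hss⟩ := Nat.find_spec hex
  have hmin : ∀ m < Nat.find hex, ∀ t t', dist C j t = 0 → dist C j t' = 0 → Near G m t t' →
      t = t' := by
    intro m hm t t' ht ht' hn
    by_contra hne'
    exact Nat.find_min hex hm ⟨by omega, t, t', ht, ht', hne', hn⟩
  generalize Nat.find hex = L at *
  have hL : 3 ≤ L := by
    by_contra hlt
    obtain ⟨u, h1, h2⟩ := Near.split (m := 1) (n := 1) (hss.mono (by omega))
    exact h.not_twoHeads hk (u := u) ⟨h.noErr u, s, s', inClosedNbhd_iff.2 h1.symm,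
      inClosedNbhd_iff.2 h2, hne, hs, hs'⟩
  -- `L = r + a + 1 + r` with `a ≤ 1`
  obtain ⟨r, a, ha, hr1, hrL⟩ : ∃ r a, a ≤ 1 ∧ 1 ≤ r ∧ L = r + (a + (1 + r)) :=
    ⟨(L - 1) / 2, (L - 1) % 2, by omega, by omega, by omega⟩
  let i : ClockIdx k := ⟨r, Finset.mem_Icc.2 ⟨hr1, by omega⟩⟩
  rw [hrL] at hss
  obtain ⟨v, hsv, hvs⟩ := hss.split
  obtain ⟨u, hvu, hus⟩ := hvs.split
  obtain ⟨v', huv, hvs'⟩ := hus.split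
  have hlevel : ∀ t t' w, dist C j t = 0 → dist C j t' = 0 → t ≠ t' → Near G r w t →
      Near G (a + 1 + r) w t' → dist C j w = r := by
    intro t t' w ht ht' htt hwt hwt'
    by_contra hlt
    have hle := h.stable.dist_le_of_near ht hwt
    obtain ⟨x, hx, hwx⟩ := h.stable.exists_leader (u := w) (by omega)
    have h1 : x = t := hmin _ (by omega) x t hx ht (hwx.symm.trans hwt)
    have h2 : x = t' := hmin _ (by omega) x t' hx ht' (hwx.symm.trans hwt')
    exact htt (h1.symm.trans h2)
  have hv : dist C j v = r := hlevel s s' v hs hs' hne hsv.symm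
    (by rw [add_assoc]; exact hvs)
  have hv' : dist C j v' = r := hlevel s' s v' hs' hs hne.symm hvs'
    (((hsv.trans (hvu.trans huv)).symm).mono (by omega))
  have hud : dist C j u ≤ r + a := h.stable.dist_le_of_near hs (hsv.trans hvu).symm
  have hvcell : v ∈ Cell G C j s i := ⟨hv.le, by rw [hv]; exact hsv.symm⟩
  have hvcell' : v' ∉ Cell G C j s i := by
    rintro ⟨_, hn⟩
    rw [hv'] at hn
    exact hne (hmin _ (by omega) s s' hs hs' (hn.symm.trans hvs'))
  obtain ⟨C₁, hr₁, hS₁, hd₁, hb₁⟩ := h.reset_arrows hk hs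
  have hI : Isolated G C₁ j s i := by
    intro t ht hn
    rw [hd₁] at ht
    exact (hmin _ (show 2 * r < L by omega) s t hs ht hn).symm
  obtain ⟨C₂, hr₂, hS₂, hd₂, ho₂, hc₂⟩ := hS₁.advance_clock hk i (by rw [hd₁]; exact hs) hI hb₁
    (2 + (C₁ v' j).c i - (C₁ s j).c i).val
  rw [cell_congr hd₁] at ho₂ hc₂
  have hvs0 : v ≠ s := by
    rintro rfl
    omega
  have hcv := hc₂ v hvcell hvs0
  rw [ZMod.natCast_zmod_val] at hcv
  have hd : ∀ w, dist C₂ j w = dist C j w := fun w => (hd₂ w).trans (hd₁ w)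
  refine hS₂.not_remoteCollision hk (u := u) ⟨hS₂.noErr u, ?_, v, v', ?_, ?_, ?_, i, ?_, ?_⟩
  · rw [hd]
    omega
  · exact inClosedNbhd_iff.2 (hvu.symm.mono ha)
  · exact inClosedNbhd_iff.2 huv
  · rw [hd, hd, hv, hv']
  · rw [hd, hv]
  · rw [hcv, ho₂ v' hvcell']
    ring

end Wave

/-- A configuration with a consistent set of leaders can be reached. -/
lemma LegitBelow.exists_good [Fintype V] {G : SimpleGraph V} {C : Config V k N} {j : Fin N}
    (h : LegitBelow G j C) (hk : 2 < k) : ∃ C', Reach G C C' ∧ Good G C' j := by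
  induction hm : (leaders C j).ncard using Nat.strong_induction_on generalizing C with
  | _ m ih =>
    by_cases hl : CanLose G C j
    · obtain ⟨C', hr, hlt⟩ := hl
      obtain ⟨D, hD, hgD⟩ := ih _ (hm ▸ hlt) (h.reach hk hr).1 rfl
      exact ⟨D, hr.trans hD, hgD⟩
    · obtain ⟨C₁, hr₁, hl₁, hle₁⟩ := h.exists_target_le hk
      have hB₁ := (h.reach hk hr₁).1
      obtain ⟨C₂, hr₂, hl₂, _, heq₂⟩ := hB₁.exists_target_eq (fun _ => True)
        (fun _ _ _ _ _ _ _ _ => trivial) hk trivial hle₁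
      have hB₂ := (hB₁.reach hk hr₂).1
      have hnl₂ : ¬ CanLose G C₂ j := fun hc =>
        hl (hc.of_reach (hr₁.trans hr₂) (by rw [hl₂, hl₁]))
      have hst₂ : Stable G C₂ j :=
        ⟨fun u hu hb => hnl₂ (canLose_of_blocked hB₂ hk hu hb), heq₂⟩
      obtain ⟨C₃, hr₃, hd₃, he₃⟩ := hst₂.exists_noErr hB₂ hk fun u hu => by
        by_contra hlt
        exact hnl₂ (hst₂.canLose_of_err hB₂ hk (by omega) hu)
      have hB₃ := hB₂.reach hk hr₃
      have hS : Stuck G C₃ j := ⟨hB₃.1, hst₂.congr hd₃ (hB₃.2.2 j le_rfl), he₃,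
        fun hc => hnl₂ (hc.of_reach_dist hr₃ hd₃)⟩
      exact ⟨C₃, (hr₁.trans hr₂).trans hr₃, hS.good hk⟩

/-! ### Adding a leader -/

/-- The invariant which is kept while distances are lowered after `u` has become a leader in
the configuration `C₀`: every node of level less than `⌊k/2⌋` either has not moved, or belongs to
the cell of `u`, where all the clocks are `0` and all the arrows point down. -/
structure Extends (G : SimpleGraph V) (C₀ : Config V k N) (j : Fin N) (u : V)
    (C : Config V k N) : Prop where
  noErr : NoErr C j
  dist_le : ∀ w, dist C j w ≤ dist C₀ j w
  old_or_new : ∀ w, dist C j w < k / 2 → C w j = C₀ w j ∨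
    (Near G (dist C j w) u w ∧
      ∀ i : ClockIdx k, dist C j w ≤ (i : ℕ) → (C w j).c i = 0 ∧ (C w j).b i = .down)

section Extend

variable {G : SimpleGraph V} {C C' C₀ : Config V k N} {j : Fin N} {u v w s t : V} {n : ℕ}

lemma Extends.update (h : Extends G C₀ j u C) (h₀ : Stable G C₀ j)
    (hlt : targetDist G C j w < dist C j w) (hc : Command G C j w .updateDistance (C' w j))
    (hv : ∀ v, v ≠ w → C' v j = C v j) : Extends G C₀ j u C' := by
  have h1 : dist C' j w = targetDist G C j w := hc.1
  refine ⟨fun v => ?_, fun v => ?_, fun v hvk => ?_⟩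
  · by_cases hvw : v = w
    · subst hvw
      exact hc.2.1.trans (h.noErr v)
    · rw [hv v hvw]
      exact h.noErr v
  · by_cases hvw : v = w
    · subst hvw
      have := h.dist_le v
      omega
    · rw [dist_eq_of_ne (hv v hvw)]
      exact h.dist_le v
  · by_cases hvw : v = w
    · subst hvw
      have hc2 := hc.2.2
      rw [if_pos (show ((C' v j).d : ℕ) < k / 2 from hvk)] at hc2
      obtain ⟨p, hp, hpd, hpc⟩ := hc2
      have hpd' : dist C j p + 1 = dist C' j v := hpd
      rcases h.old_or_new p (by omega) with hold | ⟨hnear, hnew⟩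
      · -- a neighbour of `v` that has not moved cannot give `v` a smaller level than before
        have hd := dist_eq_of_ne hold
        have := h₀.dist_le_succ hp
        have := h.dist_le v
        omega
      · refine Or.inr ⟨?_, fun i hi => ?_⟩
        · rw [← hpd']
          exact hnear.trans (Near.of_adj hp.symm)
        · have hn := hnew i (by omega)
          have hpc := hpc i
          rw [if_pos (show ((C' v j).d : ℕ) ≤ (i : ℕ) from hi),
            if_pos (show ((C' v j).d : ℕ) ≤ (i : ℕ) from hi)] at hpc
          exact ⟨hpc.1.trans hn.1, hpc.2.trans hn.2⟩
    · rw [dist_eq_of_ne (hv v hvw)] at hvk ⊢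
      rw [hv v hvw]
      exact h.old_or_new v hvk

lemma Extends.coherent (h : Extends G C₀ j u C) (h₀ : Good G C₀ j) (hk : 2 < k)
    (hfar : ∀ s, dist C₀ j s = 0 → (k : ℕ∞) ≤ G.edist u s) : Coherent G C j := by
  intro w p hp i hi
  have hi2 := Finset.mem_Icc.1 i.2
  have hd := hp.2
  -- an old and a new node of small level are not adjacent, as the new leader is far away
  have key : ∀ x y, G.Adj x y → dist C j x + 1 + dist C j y < k → dist C j y < k - 1 →
      Near G (dist C j x) u x → C y j = C₀ y j → False := by
    intro x y hxy hlt hy hx hy₀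
    rw [dist_eq_of_ne hy₀] at hlt hy
    obtain ⟨s, hs, hys⟩ := h₀.stable.exists_leader hy
    exact not_near_of_le_edist (hfar s hs) hlt ((hx.trans (Near.of_adj hxy)).trans hys)
  rcases h.old_or_new w (by omega) with hw | ⟨hwn, hw⟩
  · rcases h.old_or_new p (by omega) with hp' | ⟨hpn, _⟩
    · rw [hw, hp']
      refine h₀.coherent w p ⟨hp.1, ?_⟩ i ?_
      · rw [← dist_eq_of_ne hw, ← dist_eq_of_ne hp']
        exact hd
      · rw [← dist_eq_of_ne hw]
        exact hi
    · exact (key p w hp.1.symm (by omega) (by omega) hpn hw).elim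
  · rcases h.old_or_new p (by omega) with hp' | ⟨_, hp'⟩
    · exact (key w p hp.1 (by omega) (by omega) hwn hp').elim
    · have h1 := hw i hi
      have h2 := hp' i (by omega)
      exact Or.inr (Or.inr (Or.inr ⟨h1.2, h2.2, by rw [h1.1, h2.1]⟩))

/-- An unblocked node at distance at least `k` from all leaders can become a leader. -/
lemma Good.exists_more_leaders [Fintype V] (h : Good G C j) (hB : LegitBelow G j C) (hk : 2 < k)
    (hu : ¬ LowerLeader C j u) (hfar : ∀ s, dist C j s = 0 → (k : ℕ∞) ≤ G.edist u s) :
    ∃ C', Reach G C C' ∧ Good G C' j ∧ (leaders C j).ncard < (leaders C' j).ncard := by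
  have hlevel : ∀ v, Near G 1 u v → dist C j v = k - 1 := by
    intro v hv
    by_contra hne
    have := dist_lt C j v
    obtain ⟨s, hs, hvs⟩ := h.stable.exists_leader (u := v) (by omega)
    exact not_near_of_le_edist (hfar s hs) (by omega) (hv.trans hvs)
  have hdu := hlevel u (Near.refl u)
  have hg : Guard G C j u .becomeLeader :=
    ⟨h.noErr u, hdu, fun v hv => hlevel v (Near.of_adj hv), hu⟩
  have hel : Eligible G C j u .becomeLeader := by
    refine ⟨hg, fun R' hR' => ?_⟩
    cases R' with
    | updateDistance => exact absurd hR' h.stable.not_updateDistance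
    | belongToTwo => exact absurd hR' h.stable.not_belongToTwo
    | _ => simp [Rule.priority]
  obtain ⟨C₁, hr₁, hB₁, hlow₁, hc₁, hv₁⟩ := hB.exec hk hel
  have hd₁ : dist C₁ j u = 0 := hc₁.1
  have hdle : ∀ w, dist C₁ j w ≤ dist C j w := by
    intro w
    by_cases hw : w = u
    · subst hw
      omega
    · rw [dist_eq_of_ne (hv₁ w hw)]
  have hext : Extends G C j u C₁ := by
    refine ⟨fun w => ?_, hdle, fun w _ => ?_⟩
    · by_cases hw : w = u
      · subst hw
        exact hc₁.2.1.trans (h.noErr w)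
      · rw [hv₁ w hw]
        exact h.noErr w
    · by_cases hw : w = u
      · subst hw
        exact Or.inr ⟨Near.refl w, fun i _ => hc₁.2.2 i⟩
      · exact Or.inl (hv₁ w hw)
  have hle : ∀ w, dist C₁ j w ≠ 0 → targetDist G C₁ j w ≤ dist C₁ j w := by
    intro w hw0
    have hw : w ≠ u := by
      rintro rfl
      exact hw0 hd₁
    rw [dist_eq_of_ne (hv₁ w hw)] at hw0 ⊢
    rw [h.stable.eq_target w hw0]
    exact targetDist_mono hdle
  obtain ⟨C₂, hr₂, hl₂, hext₂, heq₂⟩ := hB₁.exists_target_eq (Extends G C j u)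
    (fun _ _ _ hP _ hlt hc hv => hP.update h.stable hlt hc hv) hk hext hle
  have hleaders : leaders C₂ j = insert u (leaders C j) := by
    rw [hl₂]
    ext w
    show dist C₁ j w = 0 ↔ w = u ∨ dist C j w = 0
    by_cases hw : w = u
    · subst hw
      simp [hd₁]
    · rw [dist_eq_of_ne (hv₁ w hw)]
      simp [hw]
  have hlow₂ := (hB₁.reach hk hr₂).2.2 j le_rfl
  refine ⟨C₂, hr₁.trans hr₂, ⟨⟨fun w hw => ?_, heq₂⟩, hext₂.noErr, hext₂.coherent h hk hfar, ?_⟩,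
    ?_⟩
  · rw [hlow₂, hlow₁]
    have hw' : w ∈ leaders C₂ j := hw
    rw [hleaders] at hw'
    rcases hw' with rfl | hw'
    · exact hu
    · exact h.stable.unblocked w hw'
  · rw [hleaders]
    rintro v (rfl | hv) w (rfl | hw) hne
    · exact absurd rfl hne
    · exact hfar w hw
    · rw [edist_comm]
      exact hfar v hv
    · exact h.separated v hv w hw hne
  · have hu0 : u ∉ leaders C j := fun (hu0 : dist C j u = 0) => by omega
    rw [hleaders, Set.ncard_insert_of_notMem hu0 (Set.toFinite _)]
    omega

lemma Good.exists_legit [Fintype V] (h : Good G C j) (hB : LegitBelow G j C) (hk : 2 < k) :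
    ∃ C', Reach G C C' ∧ Legit G C' j := by
  induction hm : Fintype.card V - (leaders C j).ncard
    using Nat.strong_induction_on generalizing C with
  | _ m ih =>
    by_cases hcov : ∀ u, ¬ LowerLeader C j u → ∃ s ∈ leaders C j, G.edist u s < k
    · exact ⟨C, .refl, h, hcov⟩
    · push Not at hcov
      obtain ⟨u, hu, hfar⟩ := hcov
      obtain ⟨C', hr, hg, hlt⟩ := h.exists_more_leaders hB hk hu hfar
      have hle : (leaders C' j).ncard ≤ Fintype.card V := by
        rw [← Nat.card_eq_fintype_card]
        exact Set.ncard_le_card _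
      obtain ⟨D, hD, hl⟩ := ih _ (by omega) hg (hB.reach hk hr).1 rfl
      exact ⟨D, hr.trans hD, hl⟩

/-- From every configuration one can reach a configuration which is legitimate for all the
algorithms. -/
lemma exists_reach_legit [Fintype V] (G : SimpleGraph V) (C : Config V k N) (hk : 2 < k) :
    ∃ C', Reach G C C' ∧ ∀ j, Legit G C' j := by
  have : ∀ n ≤ N, ∃ C', Reach G C C' ∧ LegitBelow G n C' := by
    intro n
    induction n with
    | zero => exact fun _ => ⟨C, .refl, fun p hp => absurd hp (Nat.not_lt_zero _)⟩
    | succ n ih =>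
      intro hn
      obtain ⟨C₁, hr₁, hB₁⟩ := ih (by omega)
      obtain ⟨C₂, hr₂, hg₂⟩ := LegitBelow.exists_good (j := ⟨n, hn⟩) hB₁ hk
      have hB₂ := (hB₁.reach hk hr₂).1
      obtain ⟨C₃, hr₃, hl₃⟩ := hg₂.exists_legit hB₂ hk
      refine ⟨C₃, (hr₁.trans hr₂).trans hr₃, fun p hp => ?_⟩
      rcases Nat.lt_succ_iff_lt_or_eq.1 hp with hp | hp
      · exact (hB₂.reach hk hr₃).1 p hp
      · have : p = ⟨n, hn⟩ := Fin.ext hp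
        rw [this]
        exact hl₃
  obtain ⟨C', hr, hB⟩ := this N le_rfl
  exact ⟨C', hr, fun j => hB j j.2⟩

end Extend

/-! ### Executions -/

instance : Finite Arrow :=
  Finite.of_injective (fun a : Arrow => match a with | .up => true | .down => false)
    (by rintro (_ | _) (_ | _) h <;> simp_all)

instance : Finite (LocalState k) :=
  Finite.of_injective (fun s : LocalState k => (s.d, s.err, s.c, s.b))
    (by rintro ⟨_, _, _, _⟩ ⟨_, _, _, _⟩ h; simpa using h)

lemma IsGoudaExecution.frequently_of_reach {G : SimpleGraph V} {σ : ℕ → Config V k N}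
    (hσ : IsGoudaExecution G σ) {C C' : Config V k N} (hr : Reach G C C')
    (h : ∃ᶠ n in Filter.atTop, σ n = C) : ∃ᶠ n in Filter.atTop, σ n = C' := by
  induction hr with
  | refl => exact h
  | tail _ hs ih => exact hσ.2 _ _ hs ih

/-- An execution under the Gouda daemon reaches a configuration legitimate for all the algorithms:
some configuration occurs infinitely often, hence so does everything reachable from it. -/
lemma IsGoudaExecution.exists_legit [Fintype V] {G : SimpleGraph V} {σ : ℕ → Config V k N}
    (hσ : IsGoudaExecution G σ) (hk : 2 < k) : ∃ n, ∀ j, Legit G (σ n) j := by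
  obtain ⟨C, hC⟩ := Finite.exists_infinite_fiber σ
  have hfreq : ∃ᶠ n in Filter.atTop, σ n = C :=
    Nat.frequently_atTop_iff_infinite.2 (Set.infinite_coe_iff.1 hC)
  obtain ⟨C', hr, hl⟩ := exists_reach_legit G C hk
  obtain ⟨n, hn⟩ := (hσ.frequently_of_reach hr hfreq).exists
  exact ⟨n, hn ▸ hl⟩

lemma IsExecution.legit {G : SimpleGraph V} {τ : ℕ → Config V k N} (hτ : IsExecution G τ)
    (hk : 2 < k) (h0 : ∀ j, Legit G (τ 0) j) (m : ℕ) :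
    (∀ j, Legit G (τ m) j) ∧ ∀ j, leaders (τ m) j = leaders (τ 0) j := by
  induction m with
  | zero => exact ⟨h0, fun _ => rfl⟩
  | succ m ih =>
    rcases hτ m with hs | ⟨_, he⟩
    · have hB : LegitBelow G N (τ m) := fun p _ => ih.1 p
      exact ⟨fun j => hB.step hk hs j j.2,
        fun j => (leaders_congr fun u => hB.step_dist hk hs j.2 u).trans (ih.2 j)⟩
    · rw [he]
      exact ih

end RulingColoring

theorem mainTheorem3 {V : Type*} [Fintype V] (G : SimpleGraph V) [DecidableRel G.Adj]
    (hΔ : 2 ≤ G.maxDegree) (k K : ℕ) (hk : 2 < k) (hK : K < k)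
    (σ : ℕ → RulingColoring.Config V k (G.maxDegree ^ k))
    (hσ : RulingColoring.IsGoudaExecution G σ) :
    ∃ n : ℕ, RulingColoring.Correct G K (σ n) ∧
      ∀ τ : ℕ → RulingColoring.Config V k (G.maxDegree ^ k),
        RulingColoring.IsExecution G τ → τ 0 = σ n →
          ∀ m : ℕ, RulingColoring.Correct G K (τ m) ∧
            ∀ i, RulingColoring.leaders (τ m) i = RulingColoring.leaders (σ n) i := by
  obtain ⟨n, hn⟩ := hσ.exists_legit hk
  refine ⟨n, RulingColoring.correct_of_legit G hΔ K hk hK _ hn, fun τ hτ h0 m => ?_⟩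
  have h := hτ.legit hk (by rw [h0]; exact hn) m
  exact ⟨RulingColoring.correct_of_legit G hΔ K hk hK _ h.1, fun i => by rw [h.2 i, h0]⟩
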